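/- Let $\kappa$ be a weakly compact cardinal ($\kappa=\aleph_0$ allowed), i.e. an infinite regular cardinal with the tree property such that $\alpha^{\gamma}<\kappa$ for all $\alpha,\gamma<\kappa$. A category is $(\kappa,\kappa)$-coherent if it has $\kappa$-small limits, pullback-stable effective epi-mono factorizations and pullback-stable unions of fewer than $\kappa$ subobjects, and if, moreover, for every rooted cotree in which the immediate predecessors of each vertex that has any form an extremal epimorphic family of size $<\kappa$ and every branch has size $<\kappa$ and is continuous (vertices at limit stages are the limits of the preceding ones), the transfinite cocompositions of the branches (the projections from their limits to the root) form an extremal epimorphic family on the root. A functor is $(\kappa,\kappa)$-coherent if it preserves $\kappa$-small limits, effective epimorphisms and unions of fewer than $\kappa$ subobjects. Let $\mathcal{C}$ be a small $(\kappa,\kappa)$-coherent category with disjoint coproducts of families of size $<\kappa$. Let $B$ be a Boolean algebra that is $(\kappa,\kappa)$-coherent as a category, let $Sh(B)$ be the category of sheaves on $B$ for the topology whose covers are the unions of fewer than $\kappa$ elements, and let $N:\mathcal{C}\to Sh(B)$ be a $(\kappa,\kappa)$-coherent functor. Write $\Gamma N:\mathcal{C}\to\mathbf{Set}$, $x\mapsto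 N(x)(\top)$, and let $\mathcal{C}_{\Gamma N}$ be the 2-colimit in $\mathbf{Cat}$ of the slices $\mathcal{C}/x$ and pullback functors, indexed by the pairs $(x,s)\in(\int\Gamma N)^{op}$, $s\in\Gamma N(x)$. For $f:y\to x$ and $s\in\Gamma N(x)$ write $f^s$ for the object of $\mathcal{C}_{\Gamma N}$ given by the object $f$ of the slice $\mathcal{C}/x$ indexed by $(x,s)$. Let $Sub^{\neg}(-)$ denote the poset of complemented subobjects. Then $\mathcal{C}_{\Gamma N}$ has a terminal object $1$, and: (1) $Sub^{\neg}_{\mathcal{C}_{\Gamma N}}(1)=\operatorname{colim}_{(x,s)\in(\int\Gamma N)^{op}}Sub^{\neg}_{\mathcal{C}}(x)$. That is, each complemented $u\hookrightarrow x$ and $s\in\Gamma N(x)$ give a complemented subobject $[u\hookrightarrow x^s]$ of $1$, namely the one represented by $u^s\to 1$; every complemented subobject of $1$ is of this form; and $[u\hookrightarrow x^s]\le[v\hookrightarrow y^t]$ iff there are $z\in\mathcal{C}$, $r\in\Gamma N(z)$, $f:z\to x$ and $g:z\to y$ with $\Gamma N(f)(r)=s$, $\Gamma N(g)(r)=t$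 and $f^{-1}u\le g^{-1}v$. (2) There is an isomorphism of Boolean algebras $\psi:B\to Sub^{\neg}_{\mathcal{C}_{\Gamma N}}(1)$, the Boolean operations on the right being meets, joins and complements in the poset of all subobjects of $1$. (3) For $b\in B$, there is a unique section $(*|_b,*|_{\neg b})\in N(1\sqcup 1)(\top)$ whose restriction to $b$ lies in the image of $N(i_1)_b:N(1)(b)\to N(1\sqcup 1)(b)$ and whose restriction to $\neg b$ lies in the image of $N(i_2)_{\neg b}:N(1)(\neg b)\to N(1\sqcup1)(\neg b)$, where $i_1,i_2:1\to1\sqcup1$ are the coproduct injections; and $\psi(b)=[1\sqcup\emptyset\hookrightarrow(1\sqcup1)^{(*|_b,*|_{\neg b})}]$. (4) The inverse of $\psi$ is as follows: if $u\hookrightarrow x$ is complemented with complement $u^c$ and $s\in\Gamma N(x)$, then $\psi^{-1}([u\hookrightarrow x^s])$ is the unique $b\in B$ with $s|_b\in N(u)(b)$ and $s|_{\neg b}\in N(u^c)(\neg b)$. -/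

import Mathlib

open CategoryTheory CategoryTheory.Limits Opposite Cardinal

universe u v w v' w'

/-! ### Trees and weakly compact cardinals -/

/-- A (set-theoretic) tree: a partial order in which the set of elements below any given element
is well-ordered. -/
class IsOrderTree (T : Type w) [PartialOrder T] : Prop where
  isWellOrder_Iio : ∀ t : T, IsWellOrder (Set.Iio t) (· < ·)

/-- The height of `t`, i.e. the index of its level: the order type of the elements below `t`. -/
noncomputable def treeHeight {T : Type w} [PartialOrder T] [IsOrderTree T] (t : T) : Ordinal.{w} :=
  haveI := IsOrderTree.isWellOrder_Iio t
  Ordinal.type (fun a b : Set.Iio t => a < b)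

/-- The tree property: every tree of height `κ` all of whose levels have size `< κ` has a branch
of size `κ`. -/
def HasTreeProperty (κ : Cardinal.{u}) : Prop :=
  ∀ (T : Type u) [PartialOrder T] [IsOrderTree T],
    (∀ t : T, treeHeight t < κ.ord) →
    (∀ α < κ.ord, ∃ t : T, treeHeight t = α) →
    (∀ α < κ.ord, #{t : T // treeHeight t = α} < κ) →
    ∃ b : Set T, IsMaxChain (· ≤ ·) b ∧ #b = κ

/-- Weakly compact cardinals (`ℵ₀` is allowed): infinite regular, with `(< κ)^(< κ) = (< κ)` and
the tree property. -/
structure IsWeaklyCompact (κ : Cardinal.{u}) : Prop where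
  isRegular : κ.IsRegular
  power_lt : ∀ α < κ, ∀ γ < κ, α ^ γ < κ
  treeProperty : HasTreeProperty κ

/-! ### `κ`-lex and `(lam, κ)`-coherent categories and functors -/

section Coherent

variable {C : Type w} [Category.{v} C]

/-- A category is `κ`-lex if it has all limits of diagrams with fewer than `κ` arrows. -/
def IsLexCategory (κ : Cardinal.{u}) (C : Type w) [Category.{v} C] : Prop :=
  ∀ (J : Type u) [SmallCategory J], HasCardinalLT (Arrow J) κ → HasLimitsOfShape J C

/-- A functor is `κ`-lex if it preserves all limits of diagrams with fewer than `κ` arrows. -/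
def IsLexFunctor (κ : Cardinal.{u}) {D : Type w'} [Category.{v'} D] (F : C ⥤ D) : Prop :=
  ∀ (J : Type u) [SmallCategory J], HasCardinalLT (Arrow J) κ → PreservesLimitsOfShape J F

/-- `n : V ⟶ X` is the union (as a subobject of `X`) of the family `m i : U i ⟶ X`: it is the
least subobject of `X` through which all the `m i` factor. -/
structure IsUnion {X : C} {ι : Type*} {U : ι → C} (m : ∀ i, U i ⟶ X) {V : C} (n : V ⟶ X) :
    Prop where
  mono : Mono n
  factors : ∀ i, ∃ k : U i ⟶ V, k ≫ n = m i
  least : ∀ {W : C} (p : W ⟶ X) [Mono p], (∀ i, ∃ k : U i ⟶ W, k ≫ p = m i) →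
    ∃ k : V ⟶ W, k ≫ p = n

/-- A family of maps with common codomain `X` is extremal epimorphic if it does not factor through
any proper subobject of `X`. -/
def IsExtremalEpiFamily {X : C} {ι : Type*} {U : ι → C} (m : ∀ i, U i ⟶ X) : Prop :=
  ∀ {W : C} (p : W ⟶ X) [Mono p], (∀ i, ∃ k : U i ⟶ W, k ≫ p = m i) → IsIso p

/-- The restriction of a diagram `D` indexed by the opposite of a poset to a subset of the poset. -/
def restrictDiagram {T : Type u} [PartialOrder T] (D : Tᵒᵖ ⥤ C) (b : Set T) : bᵒᵖ ⥤ C where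
  obj s := D.obj (op s.unop.1)
  map f := D.map (homOfLE (Subtype.coe_le_coe.2 (leOfHom f.unop))).op
  map_id s := D.map_id _
  map_comp f g := by rw [← D.map_comp]; rfl

/-- The canonical cone with vertex `D t` over the restriction of `D` to the elements below `t`. -/
def coneBelow {T : Type u} [PartialOrder T] (D : Tᵒᵖ ⥤ C) (t : T) :
    Cone (restrictDiagram D (Set.Iio t)) where
  pt := D.obj (op t)
  π :=
    { app := fun s => D.map (homOfLE (le_of_lt s.unop.2)).op
      naturality := fun s s' f => by
        dsimp [restrictDiagram]
        rw [Category.id_comp, ← D.map_comp]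
        rfl }

/-- A rooted cotree in `C` (the root being the vertex of `⊥ : T`) such that the immediate
predecessors of every vertex (other than the endpoints of branches) form an extremal epimorphic
family of size `< lam`, and such that every branch has size `< κ` and is continuous. -/
structure IsCoveringCotree (lam κ : Cardinal.{u}) {T : Type u} [PartialOrder T] [OrderBot T]
    [IsOrderTree T] (D : Tᵒᵖ ⥤ C) : Prop where
  card_succ : ∀ t : T, HasCardinalLT {s : T // t ⋖ s} lam
  extremal : ∀ t : T, ¬ IsMax t →
    IsExtremalEpiFamily (fun s : {s : T // t ⋖ s} => D.map (homOfLE s.2.le).op)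
  card_branch : ∀ b : Set T, IsMaxChain (· ≤ ·) b → HasCardinalLT b κ
  continuous : ∀ t : T, Order.IsSuccLimit t → Nonempty (IsLimit (coneBelow D t))

/-- `(lam, κ)`-coherent categories. -/
structure IsCoherentCategory (lam κ : Cardinal.{u}) (C : Type w) [Category.{v} C] : Prop where
  isLex : IsLexCategory κ C
  /-- effective epi-mono factorizations exist and are stable under pullback -/
  exists_factorization : ∀ {X Y : C} (f : X ⟶ Y),
    ∃ (I : C) (e : X ⟶ I) (m : I ⟶ Y), EffectiveEpi e ∧ Mono m ∧ e ≫ m = f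
  effectiveEpi_of_isPullback : ∀ {X Y X' Y' : C} {g' : X' ⟶ X} {f' : X' ⟶ Y'} {f : X ⟶ Y}
    {g : Y' ⟶ Y}, IsPullback g' f' f g → EffectiveEpi f → EffectiveEpi f'
  /-- unions of fewer than `lam` subobjects exist and are stable under pullback -/
  exists_union : ∀ {X : C} {ι : Type u} {U : ι → C} (m : ∀ i, U i ⟶ X) [∀ i, Mono (m i)],
    HasCardinalLT ι lam → ∃ (V : C) (n : V ⟶ X), IsUnion m n
  isUnion_of_isPullback : ∀ {X X' : C} (f : X' ⟶ X) {ι : Type u} {U U' : ι → C}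
    (m : ∀ i, U i ⟶ X) [∀ i, Mono (m i)] (m' : ∀ i, U' i ⟶ X') (g : ∀ i, U' i ⟶ U i)
    {V V' : C} (n : V ⟶ X) (n' : V' ⟶ X') (h : V' ⟶ V),
    HasCardinalLT ι lam → (∀ i, IsPullback (g i) (m' i) (m i) f) → IsPullback h n' n f →
    IsUnion m n → IsUnion m' n'
  /-- the transfinite cocompositions of the branches of a covering cotree cover the root -/
  cotree : ∀ {T : Type u} [PartialOrder T] [OrderBot T] [IsOrderTree T] (D : Tᵒᵖ ⥤ C),
    IsCoveringCotree lam κ D →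
    ∀ c : ∀ b : {b : Set T // IsMaxChain (· ≤ ·) b}, LimitCone (restrictDiagram D b.1),
      IsExtremalEpiFamily (X := D.obj (op ⊥)) (U := fun b => (c b).cone.pt)
        (fun b => (c b).cone.π.app (op ⟨⊥, b.2.bot_mem⟩))

/-- `(lam, κ)`-coherent functors: they preserve `κ`-small limits, effective epimorphisms and
unions of fewer than `lam` subobjects. -/
structure IsCoherentFunctor (lam κ : Cardinal.{u}) {D : Type w'} [Category.{v'} D] (F : C ⥤ D) :
    Prop where
  isLex : IsLexFunctor κ F
  effectiveEpi : ∀ {X Y : C} (f : X ⟶ Y), EffectiveEpi f → EffectiveEpi (F.map f)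
  isUnion : ∀ {X : C} {ι : Type u} {U : ι → C} (m : ∀ i, U i ⟶ X) [∀ i, Mono (m i)]
    {V : C} (n : V ⟶ X), HasCardinalLT ι lam → IsUnion m n →
    IsUnion (fun i => F.map (m i)) (F.map n)

/-- The category has coproducts of families of size `< κ`, and these are disjoint. -/
structure HasSmallDisjointCoproducts (κ : Cardinal.{u}) (C : Type w) [Category.{v} C] : Prop where
  hasCoproducts : ∀ ι : Type u, HasCardinalLT ι κ → HasColimitsOfShape (Discrete ι) C
  disjoint : ∀ {ι : Type u} (X : ι → C), HasCardinalLT ι κ → CoproductDisjoint X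

theorem IsLexCategory.hasFiniteLimits {κ : Cardinal.{u}} (h : IsLexCategory κ C)
    (hκ : ℵ₀ ≤ κ) : HasFiniteLimits C where
  out J _ _ := by
    have hJ : HasCardinalLT (Arrow (ULiftHom.{u} (ULift.{u} J))) κ := by
      have : Finite (Arrow (ULiftHom.{u} (ULift.{u} J))) := by
        have : FinCategory (ULiftHom.{u} (ULift.{u} J)) := inferInstance
        have e : Arrow (ULiftHom.{u} (ULift.{u} J)) ≃
            Σ (a b : ULiftHom.{u} (ULift.{u} J)), (a ⟶ b) :=
          { toFun := fun f => ⟨f.left, f.right, f.hom⟩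
            invFun := fun x => Arrow.mk x.2.2
            left_inv := fun _ => rfl
            right_inv := fun _ => rfl }
        exact Finite.of_equiv _ e.symm
      exact hasCardinalLT_of_finite _ _ hκ
    have := h (ULiftHom.{u} (ULift.{u} J)) hJ
    exact hasLimitsOfShape_of_equivalence (ULiftHomULiftCategory.equiv.{u, u} J).symm

theorem HasSmallDisjointCoproducts.hasFiniteCoproducts {κ : Cardinal.{u}}
    (h : HasSmallDisjointCoproducts κ C) (hκ : ℵ₀ ≤ κ) : HasFiniteCoproducts C where
  out n := by
    have := h.hasCoproducts (ULift.{u} (Fin n)) (hasCardinalLT_of_finite _ _ hκ)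
    exact hasColimitsOfShape_of_equivalence (Discrete.equivalence (Equiv.ulift.{u} (α := Fin n)))

end Coherent

/-! ### The topos `Sh(B)` and global sections -/

/-- The Grothendieck topology on a Boolean algebra whose covers are the unions of fewer than `κ`
elements: a sieve on `b` is covering iff it contains a family of size `< κ` with supremum `b`. -/
def unionTopology {κ : Cardinal.{u}} (hκ : κ.IsRegular) (B : Type u) [BooleanAlgebra B] :
    GrothendieckTopology B where
  sieves b := {S | ∃ (ι : Type u) (f : ι → B), HasCardinalLT ι κ ∧
    (∀ i, ∃ h : f i ⟶ b, S.arrows h) ∧ IsLUB (Set.range f) b}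
  top_mem' b := ⟨PUnit, fun _ => b, hasCardinalLT_of_finite _ _ hκ.1, fun _ => ⟨𝟙 b, trivial⟩, by
    rw [Set.range_const]; exact isLUB_singleton⟩
  pullback_stable' := by
    rintro b c S g ⟨ι, f, hι, hf, hb⟩
    refine ⟨ι, fun i => f i ⊓ c, hι, fun i => ?_, ?_, ?_⟩
    · obtain ⟨h, hS⟩ := hf i
      refine ⟨homOfLE inf_le_right, ?_⟩
      have := S.downward_closed hS (homOfLE (inf_le_left : f i ⊓ c ≤ f i))
      exact this
    · rintro _ ⟨i, rfl⟩
      exact inf_le_right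
    · intro z hz
      have h1 : b ≤ c ⇨ z := hb.2 (by
        rintro _ ⟨i, rfl⟩
        exact le_himp_iff.2 (hz ⟨i, rfl⟩))
      have h2 : b ⊓ c ≤ z := le_himp_iff.1 h1
      exact (le_inf (leOfHom g) le_rfl).trans h2
  transitive' := by
    rintro b S ⟨ι, f, hι, hf, hb⟩ R hR
    choose h hS using hf
    choose κi g hκi hg hlub using fun i => hR (hS i)
    have : Fact κ.IsRegular := ⟨hκ⟩
    refine ⟨Σ i, κi i, fun x => g x.1 x.2, hasCardinalLT_sigma _ _ hι hκi, ?_, ?_, ?_⟩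
    · rintro ⟨i, j⟩
      obtain ⟨k, hk⟩ := hg i j
      exact ⟨k ≫ h i, hk⟩
    · rintro _ ⟨⟨i, j⟩, rfl⟩
      exact ((hlub i).1 ⟨j, rfl⟩).trans (leOfHom (h i))
    · intro z hz
      refine hb.2 ?_
      rintro _ ⟨i, rfl⟩
      refine (hlub i).2 ?_
      rintro _ ⟨j, rfl⟩
      exact hz ⟨⟨i, j⟩, rfl⟩

section GlobalSections

variable {B : Type u} [BooleanAlgebra B] {J : GrothendieckTopology B}
variable {C : Type w} [Category.{v} C]

/-- `Γ N : C ⥤ Set`, the composite of `N : C ⥤ Sh(B)` with the global sections functor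
`F ↦ F(⊤)`. -/
def globalSections (N : C ⥤ Sheaf J (Type u)) : C ⥤ Type u :=
  N ⋙ sheafToPresheaf J (Type u) ⋙ (evaluation Bᵒᵖ (Type u)).obj (op ⊤)

/-- For maps `i : y ⟶ x` and `j : z ⟶ x`, a global section `s` of `N x` and `b : B`: the restriction
of `s` to `b` lies in (the image of) `N y (b)`, and the restriction of `s` to the complement of `b`
lies in (the image of) `N z (bᶜ)`. -/
def IsSplitBy (N : C ⥤ Sheaf J (Type u)) {x y z : C} (i : y ⟶ x) (j : z ⟶ x)
    (s : (globalSections N).obj x) (b : B) : Prop :=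
  (N.obj x).obj.map (homOfLE le_top : b ⟶ ⊤).op s ∈ Set.range ((N.map i).hom.app (op b)) ∧
  (N.obj x).obj.map (homOfLE le_top : bᶜ ⟶ ⊤).op s ∈ Set.range ((N.map j).hom.app (op bᶜ))

end GlobalSections

/-! ### The 2-colimit of the slices -/

section SliceColimit

variable {C : Type u} [SmallCategory C] (K : C ⥤ Type u)

/-- The total category of the fibration over the category of elements `∫ K` whose fibre over
`(x, a)` is the slice `C / x`, with reindexing given by pullback. Its objects are pairs
`(f : y ⟶ x, a ∈ K x)`; its morphisms are commutative squares over a morphism of `∫ K`. -/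
abbrev SliceTotal : Type u := Comma (𝟭 C) (CategoryOfElements.π K)

/-- The cartesian morphisms of the fibration `SliceTotal K` over `∫ K`: the pullback squares. -/
def cartesianMorphisms : MorphismProperty (SliceTotal K) := fun X Y f =>
  IsPullback f.left X.hom Y.hom ((CategoryOfElements.π K).map f.right)

/-- The category `C_K`, the 2-colimit in `Cat` of the slices `C / x` and the pullback functors
between them, indexed by `(x, a) ∈ (∫ K)ᵒᵖ`. The 2-colimit of a `Cat`-valued pseudofunctor on
`(∫ K)ᵒᵖ` is the localization of the total category of the corresponding fibration over `∫ K` at the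
cartesian morphisms. -/
abbrev SliceColimit : Type u := (cartesianMorphisms K).Localization

variable {K}

/-- The object of `C_K` given by an object `f : y ⟶ x` of the slice `C / x` marked with
`a ∈ K x`. -/
def SliceColimit.mk {y x : C} (f : y ⟶ x) (a : K.obj x) : SliceColimit K :=
  (cartesianMorphisms K).Q.obj
    { left := y, right := K.elementsMk x a, hom := f }

end SliceColimit

/-! ### Complemented subobjects -/

section Complemented

variable {D : Type w} [Category.{v} D]

/-- `p` and `q` are complements of each other in the poset of subobjects of `X`: their meet is the
least subobject and their join is the largest one. -/
def AreComplements {X : D} (p q : Subobject X) : Prop :=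
  (∀ r, r ≤ p → r ≤ q → IsBot r) ∧ (∀ r, p ≤ r → q ≤ r → IsTop r)

/-- `Sub^¬(X)`, the poset of complemented subobjects of `X`. -/
abbrev ComplementedSubobject (X : D) : Type _ := {p : Subobject X // ∃ q, AreComplements p q}

/-- `p = [f^a]`: the subobject `p` of the terminal object of `C_K` is (well-defined and)
represented by the object `f : y ⟶ x` of `C / x` marked with `a ∈ K x`. -/
def IsClassOf {C : Type u} [SmallCategory C] {K : C ⥤ Type u} [HasTerminal (SliceColimit K)]
    (p : Subobject (⊤_ (SliceColimit K))) {y x : C} (f : y ⟶ x) (a : K.obj x) : Prop :=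
  ∃ _ : Mono (terminal.from (SliceColimit.mk f a)),
    p = Subobject.mk (terminal.from (SliceColimit.mk f a))

end Complemented

/-!
The proof rests on three observations.

*The 2-colimit is a filtered one.* Since `K = ΓN` preserves finite limits, `∫ K` is cofiltered, and
the cartesian morphisms of the fibration of slices over `∫ K` admit a right calculus of fractions.
Hence a map of `C_K` is a map of `C` over some refinement of the marking elements, an object is
subterminal iff it is represented by a monomorphism after a reindexing
(`SliceTotal.exists_cartesian_mono`), and every subobject of the terminal object is a class
`[u ↪ x^a]`, these classes being ordered as the statement says (`subobjectClass_le_iff`). Meets,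
joins, the least and the greatest subobject are stable under pullback in a coherent category, so
that being complements is witnessed at a finite stage
(`exists_areComplements_eq_subobjectClass`).

*Complemented subobjects split global sections.* If `u` and `v` are complements in `x`, then `N u`
and `N v` are disjoint subsheaves of `N x` whose union is `N x`. A global section `s` of `N x` lies
therefore locally, on a cover of `⊤` by fewer than `κ` elements, in `N u` or in `N v`. The join of
the elements of the first kind is the unique `b` such that `s` lies in `N u` over `b` and in `N v`
over `bᶜ` (`AreComplements.exists_isSplitBy`).

*The classes are ordered as the splitting elements.* Let `u`, `v` be complemented in `x`, let `u'`
be the complement of `u`, and let `b ≤ c`, where `b` and `c` split `s` along `u` and along `v`.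
Then `s` lies in `N u'` over `bᶜ` and in `N v` over `c`, so that it is a global section of
`N (u' ∪ v)`; reindexing along `u' ∪ v ↪ x`, over which `u ≤ v`, shows `[u ↪ x^s] ≤ [v ↪ x^s]`
(`subobjectClass_le_iff_of_isSplitBy`). Every `b` is attained, by the first injection of `1 ⊔ 1` and
the section glued from the two injections over `b` and `bᶜ`.
The resulting order isomorphism is `ψ⁻¹`.
-/

/-! ### Complements in the subobject posets of a coherent category -/

section CoherentSubobjects

variable {C : Type w} [Category.{v} C]

theorem AreComplements.symm {X : C} {a b : Subobject X} (h : AreComplements a b) :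
    AreComplements b a :=
  ⟨fun r h₁ h₂ => h.1 r h₂ h₁, fun r h₁ h₂ => h.2 r h₂ h₁⟩

variable [HasPullbacks C]

theorem CategoryTheory.Subobject.le_pullback_iff {X Y : C} (f : X ⟶ Y) (P : Subobject X)
    (Q : Subobject Y) :
    P ≤ (Subobject.pullback f).obj Q ↔ Q.Factors (P.arrow ≫ f) := by
  constructor
  · intro h
    rw [← Subobject.ofLE_arrow h, Category.assoc, ← (Subobject.isPullback f Q).w, ← Category.assoc]
    exact Subobject.factors_comp_arrow _
  · intro h
    exact Subobject.le_of_comm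
      ((Subobject.isPullback f Q).lift (Q.factorThru _ h) P.arrow (by simp)) (by simp)

theorem CategoryTheory.Subobject.pullback_arrow_le_iff {X : C} (u a b : Subobject X) :
    (Subobject.pullback u.arrow).obj a ≤ (Subobject.pullback u.arrow).obj b ↔ u ⊓ a ≤ b := by
  rw [Subobject.inf_eq_map_pullback]
  constructor
  · intro h
    exact leOfHom (((Subobject.mapPullbackAdj u.arrow).homEquiv _ _).symm (homOfLE h))
  · intro h
    exact leOfHom (((Subobject.mapPullbackAdj u.arrow).homEquiv _ _) (homOfLE h))

variable {lam κ : Cardinal.{u}}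

/-- Any two subobjects have a join all of whose pullbacks are joins of the pullbacks. -/
theorem IsCoherentCategory.exists_stable_sup (hC : IsCoherentCategory lam κ C) (hlam : ℵ₀ ≤ lam)
    {X : C} (a b : Subobject X) :
    ∃ c : Subobject X, a ≤ c ∧ b ≤ c ∧ ∀ {Y : C} (f : Y ⟶ X) (r : Subobject Y),
      (Subobject.pullback f).obj a ≤ r → (Subobject.pullback f).obj b ≤ r →
        (Subobject.pullback f).obj c ≤ r := by
  let U : ULift.{u} Bool → Subobject X := fun i => if i.down then a else b
  have hι : HasCardinalLT (ULift.{u} Bool) lam := hasCardinalLT_of_finite _ _ hlam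
  obtain ⟨V, n, hn⟩ := hC.exists_union (fun i => (U i).arrow) hι
  have := hn.mono
  have le (i) : U i ≤ Subobject.mk n := by
    obtain ⟨k, hk⟩ := hn.factors i
    exact Subobject.le_mk_of_comm k hk
  refine ⟨Subobject.mk n, le ⟨true⟩, le ⟨false⟩, fun {Y} f r ha hb => ?_⟩
  have h := hC.isUnion_of_isPullback f (fun i => (U i).arrow) (fun i =>
    ((Subobject.pullback f).obj (U i)).arrow) (fun i => Subobject.pullbackπ f (U i)) n
    (pullback.snd n f) (pullback.fst n f) hι (fun i => Subobject.isPullback f (U i))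
    (IsPullback.of_hasPullback n f) hn
  obtain ⟨k, hk⟩ := h.least r.arrow (by
    rintro ⟨_ | _⟩
    · exact ⟨Subobject.ofLE _ _ hb, Subobject.ofLE_arrow _⟩
    · exact ⟨Subobject.ofLE _ _ ha, Subobject.ofLE_arrow _⟩)
  rw [Subobject.pullback_obj_mk (IsPullback.of_hasPullback n f)]
  exact Subobject.mk_le_of_comm k hk

/-- There is a least subobject all of whose pullbacks are least. -/
theorem IsCoherentCategory.exists_stable_bot (hC : IsCoherentCategory lam κ C) (hlam : ℵ₀ ≤ lam)
    (X : C) :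
    ∃ c : Subobject X, ∀ {Y : C} (f : Y ⟶ X), IsBot ((Subobject.pullback f).obj c) := by
  let U : PEmpty.{u + 1} → C := PEmpty.elim
  have hι : HasCardinalLT PEmpty.{u + 1} lam := hasCardinalLT_of_finite _ _ hlam
  have : ∀ i, Mono ((PEmpty.elim i : U i ⟶ X)) := fun i => i.elim
  obtain ⟨V, n, hn⟩ := hC.exists_union (fun i => (PEmpty.elim i : U i ⟶ X)) hι
  have := hn.mono
  refine ⟨Subobject.mk n, fun {Y} f r => ?_⟩
  have h := hC.isUnion_of_isPullback f (fun i => (PEmpty.elim i : U i ⟶ X))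
    (fun i => (PEmpty.elim i : U i ⟶ Y)) (fun i => i.elim) n
    (pullback.snd n f) (pullback.fst n f) hι (fun i => i.elim)
    (IsPullback.of_hasPullback n f) hn
  obtain ⟨k, hk⟩ := h.least r.arrow (fun i => i.elim)
  rw [Subobject.pullback_obj_mk (IsPullback.of_hasPullback n f)]
  exact Subobject.mk_le_of_comm k hk

/-- Half of distributivity: if `a'` is a complement of `a` and the join of `a'` and `b` is
everything, then `a ≤ b`. -/
theorem CategoryTheory.Subobject.le_of_disjoint_of_codisjoint
    (hC : IsCoherentCategory lam κ C) (hlam : ℵ₀ ≤ lam) {X : C} {a a' b : Subobject X} (h : ∀ r, r ≤ a → r ≤ a' → IsBot r)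
    (h' : ∀ r, a' ≤ r → b ≤ r → IsTop r) : a ≤ b := by
  obtain ⟨c, hc₁, hc₂, hc⟩ := hC.exists_stable_sup hlam a' b
  have key := hc a.arrow ((Subobject.pullback a.arrow).obj b)
    ((Subobject.pullback_arrow_le_iff _ _ _).2 (h _ _root_.inf_le_left _root_.inf_le_right _)) le_rfl
  rw [Subobject.pullback_arrow_le_iff] at key
  exact (_root_.le_inf le_rfl (h' c hc₁ hc₂ a)).trans key

theorem AreComplements.pullback (hC : IsCoherentCategory lam κ C) (hlam : ℵ₀ ≤ lam)
    {X Y : C} (f : Y ⟶ X) {a b : Subobject X} (h : AreComplements a b) :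
    AreComplements ((Subobject.pullback f).obj a) ((Subobject.pullback f).obj b) := by
  constructor
  · intro r ha hb s
    obtain ⟨z, hz⟩ := hC.exists_stable_bot hlam X
    refine le_trans ?_ (hz f s)
    refine (le_inf ha hb).trans ?_
    rw [← Subobject.inf_pullback]
    exact (Subobject.pullback f).monotone (h.1 _ inf_le_left inf_le_right _)
  · intro r ha hb s
    obtain ⟨c, hc₁, hc₂, hc⟩ := hC.exists_stable_sup hlam a b
    refine le_trans ?_ (hc f r ha hb)
    have : c = ⊤ := top_le_iff.1 (h.2 c hc₁ hc₂ _)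
    rw [this, Subobject.pullback_top]
    exact le_top

/-- The de Morgan law: the meet of two complemented subobjects is complemented by the join of
their complements. -/
theorem AreComplements.inf (hC : IsCoherentCategory lam κ C) (hlam : ℵ₀ ≤ lam)
    {X : C} {a a' b b' c : Subobject X} (ha : AreComplements a a') (hb : AreComplements b b')
    (hc₁ : a' ≤ c) (hc₂ : b' ≤ c) (hc : ∀ {Y : C} (f : Y ⟶ X) (r : Subobject Y),
      (Subobject.pullback f).obj a' ≤ r → (Subobject.pullback f).obj b' ≤ r →
        (Subobject.pullback f).obj c ≤ r) : AreComplements (a ⊓ b) c := by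
  constructor
  · intro r h₁ h₂ s
    refine (le_inf h₁ h₂).trans ?_
    rw [← Subobject.pullback_arrow_le_iff]
    apply hc <;> rw [Subobject.pullback_arrow_le_iff]
    · exact ha.1 _ (inf_le_left.trans inf_le_left) inf_le_right _
    · exact hb.1 _ (inf_le_left.trans inf_le_right) inf_le_right _
  · intro r h₁ h₂
    refine hb.2 r ?_ (hc₂.trans h₂)
    obtain ⟨d, hd₁, hd₂, hd⟩ := hC.exists_stable_sup hlam a a'
    have key := hd b.arrow ((Subobject.pullback b.arrow).obj r)
      ((Subobject.pullback_arrow_le_iff _ _ _).2 ((inf_comm _ _).trans_le h₁))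
      ((Subobject.pullback_arrow_le_iff _ _ _).2 (inf_le_right.trans (hc₁.trans h₂)))
    rw [Subobject.pullback_arrow_le_iff] at key
    exact (le_inf le_rfl (ha.2 d hd₁ hd₂ b)).trans key

end CoherentSubobjects

/-! ### Calculus of fractions in the 2-colimit of the slices -/

section Fractions

variable {C : Type u} [SmallCategory C] {K : C ⥤ Type u}

namespace SliceTotal

/-- The object of the fibration given by `f : y ⟶ x` and `a ∈ K x`. -/
abbrev mk {y x : C} (f : y ⟶ x) (a : K.obj x) : SliceTotal K :=
  { left := y, right := K.elementsMk x a, hom := f }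

/-- The morphism given by a commutative square. -/
abbrev homMk {X Y : SliceTotal K} (l : X.left ⟶ Y.left) (r : X.right.1 ⟶ Y.right.1)
    (hr : K.map r X.right.2 = Y.right.2)
    (w : l ≫ (show Y.left ⟶ Y.right.1 from Y.hom) = (show X.left ⟶ X.right.1 from X.hom) ≫ r) :
    X ⟶ Y :=
  { left := l, right := ⟨r, hr⟩, w := w }

theorem hom_ext' {X Y : SliceTotal K} {f g : X ⟶ Y} (hl : f.left = g.left)
    (hr : f.right.1 = g.right.1) : f = g :=
  CommaMorphism.ext hl (Subtype.ext hr)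

variable [HasPullbacks C]

/-- The reindexing of an object of the fibration along a morphism of the base. -/
theorem exists_cartesian (X : SliceTotal K) {e : K.Elements} (g : e ⟶ X.right) :
    ∃ (y : C) (f : y ⟶ e.1) (s : mk f e.2 ⟶ X), cartesianMorphisms K s ∧
      s.right = g := by
  exact ⟨_, pullback.snd X.hom ((CategoryOfElements.π K).map g),
    ⟨pullback.fst _ _, g, pullback.condition⟩, IsPullback.of_hasPullback _ _, rfl⟩

/-- Two parallel maps lie over the same map of the base after reindexing. -/
theorem exists_cartesian_right_eq [IsCofiltered K.Elements] {X Y : SliceTotal K} (f g : X ⟶ Y) :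
    ∃ (X' : SliceTotal K) (t : X' ⟶ X), cartesianMorphisms K t ∧ (t ≫ f).right = (t ≫ g).right := by
  obtain ⟨y, p, t, ht, htr⟩ := exists_cartesian X (IsCofiltered.eqHom f.right g.right)
  refine ⟨_, t, ht, ?_⟩
  rw [Comma.comp_right, Comma.comp_right, htr]
  exact IsCofiltered.eq_condition _ _

end SliceTotal

instance : (cartesianMorphisms K).IsMultiplicative where
  id_mem X := by
    show IsPullback _ _ _ _
    have : IsIso (CommaMorphism.left (𝟙 X)) := inferInstanceAs (IsIso (𝟙 X.left))
    have : IsIso ((CategoryOfElements.π K).map (CommaMorphism.right (𝟙 X))) :=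
      inferInstanceAs (IsIso ((CategoryOfElements.π K).map (𝟙 X.right)))
    exact IsPullback.of_horiz_isIso ⟨CommaMorphism.w (𝟙 X)⟩
  comp_mem f g hf hg := by
    exact IsPullback.paste_horiz hf hg

theorem cartesianMorphisms.hom_ext {X Y Z : SliceTotal K} {s : Y ⟶ Z}
    (hs : cartesianMorphisms K s) {f g : X ⟶ Y} (h : f ≫ s = g ≫ s)
    (hr : f.right = g.right) : f = g := by
  refine CommaMorphism.ext ?_ hr
  refine IsPullback.hom_ext hs ?_ ?_
  · exact congr_arg CommaMorphism.left h
  · have hf := f.w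
    have hg := g.w
    dsimp at hf hg
    rw [hf, hg, hr]

instance [HasFiniteLimits C] [PreservesFiniteLimits K] :
    (cartesianMorphisms K).HasRightCalculusOfFractions where
  exists_rightFraction X Y φ := by
    have := K.isCofiltered_elements
    obtain ⟨e, g₁, g₂, hg⟩ := IsCofiltered.cospan φ.f.right φ.s.right
    obtain ⟨y, p, t, ht, rfl⟩ := SliceTotal.exists_cartesian X g₁
    have w : (t.left ≫ φ.f.left) ≫ φ.Y'.hom =
        (p ≫ (CategoryOfElements.π K).map g₂) ≫ (CategoryOfElements.π K).map φ.s.right :=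
      (t ≫ φ.f).w.trans ((congrArg (fun k => p ≫ (CategoryOfElements.π K).map k) hg).trans
        (Category.assoc _ _ _).symm)
    refine ⟨⟨t, ht, ⟨IsPullback.lift φ.hs _ _ w, g₂, IsPullback.lift_snd φ.hs _ _ w⟩⟩, ?_⟩
    exact CommaMorphism.ext (IsPullback.lift_fst φ.hs _ _ w).symm hg
  ext X Y Z f₁ f₂ s hs h := by
    have := K.isCofiltered_elements
    obtain ⟨X', t, ht, hr⟩ := SliceTotal.exists_cartesian_right_eq f₁ f₂
    exact ⟨X', t, ht, cartesianMorphisms.hom_ext hs (by simp [h]) hr⟩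

end Fractions

/-! ### Subobjects of the terminal object of the 2-colimit -/

section SubterminalObjects

variable {C : Type u} [SmallCategory C] {K : C ⥤ Type u} [HasFiniteLimits C]
  [PreservesFiniteLimits K]

theorem SliceTotal.exists_isTerminal : ∃ T : SliceTotal K, Nonempty (IsTerminal T) := by
  let e := Types.isTerminalEquivUnique _ (terminalIsTerminal.isTerminalObj K)
  refine ⟨SliceTotal.mk (𝟙 (⊤_ C)) e.default, ⟨IsTerminal.ofUniqueHom (fun X =>
    SliceTotal.homMk (terminal.from _) (terminal.from _) (e.uniq _) ?_) ?_⟩⟩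
  · exact terminal.hom_ext _ _
  · intro X m
    exact SliceTotal.hom_ext' (terminal.hom_ext _ _) (terminal.hom_ext _ _)

/-- Up to reindexing the source, each map of the 2-colimit comes from the fibration. -/
theorem SliceColimit.exists_map_eq {X Y : SliceTotal K}
    (f : (cartesianMorphisms K).Q.obj X ⟶ (cartesianMorphisms K).Q.obj Y) :
    ∃ (X' : SliceTotal K) (s : X' ⟶ X) (g : X' ⟶ Y), cartesianMorphisms K s ∧
      (cartesianMorphisms K).Q.map s ≫ f = (cartesianMorphisms K).Q.map g := by
  obtain ⟨φ, rfl⟩ := Localization.exists_rightFraction (cartesianMorphisms K).Q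
    (cartesianMorphisms K) f
  exact ⟨_, φ.s, φ.f, φ.hs, φ.map_s_comp_map _ _⟩

instance SliceColimit.hasTerminal : HasTerminal (SliceColimit K) := by
  obtain ⟨T, ⟨hT⟩⟩ := SliceTotal.exists_isTerminal (K := K)
  refine IsTerminal.hasTerminal (X := (cartesianMorphisms K).Q.obj T)
    (IsTerminal.ofUniqueHom (fun A => ((cartesianMorphisms K).Q.objObjPreimageIso A).inv ≫
      (cartesianMorphisms K).Q.map (hT.from _)) fun A m => ?_)
  rw [Iso.eq_inv_comp]
  obtain ⟨X', s, g, hs, h⟩ := SliceColimit.exists_map_eq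
    (((cartesianMorphisms K).Q.objObjPreimageIso A).hom ≫ m)
  have := Localization.inverts (cartesianMorphisms K).Q (cartesianMorphisms K) s hs
  rw [← cancel_epi ((cartesianMorphisms K).Q.map s), h, ← Functor.map_comp]
  congr 1
  exact hT.hom_ext _ _

instance SliceColimit.mono_terminal_from {y x : C} (f : y ⟶ x) [Mono f] (a : K.obj x) :
    Mono (terminal.from (SliceColimit.mk f a)) := by
  constructor
  intro A g₁ g₂ _
  change A ⟶ (cartesianMorphisms K).Q.obj (SliceTotal.mk f a) at g₁ g₂
  change @Eq (A ⟶ (cartesianMorphisms K).Q.obj (SliceTotal.mk f a)) g₁ g₂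
  -- the two maps become images of maps of the fibration after composition with isomorphisms
  rw [← cancel_epi ((cartesianMorphisms K).Q.objObjPreimageIso A).hom]
  obtain ⟨X, s, h₁, hs, e₁⟩ := SliceColimit.exists_map_eq (Y := SliceTotal.mk f a)
    (((cartesianMorphisms K).Q.objObjPreimageIso A).hom ≫ g₁)
  have := Localization.inverts (cartesianMorphisms K).Q (cartesianMorphisms K) s hs
  rw [← cancel_epi ((cartesianMorphisms K).Q.map s), e₁]
  obtain ⟨X', s', h₂, hs', e₂⟩ := SliceColimit.exists_map_eq (Y := SliceTotal.mk f a)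
    ((cartesianMorphisms K).Q.map s ≫
      ((cartesianMorphisms K).Q.objObjPreimageIso A).hom ≫ g₂)
  have := Localization.inverts (cartesianMorphisms K).Q (cartesianMorphisms K) s' hs'
  rw [← cancel_epi ((cartesianMorphisms K).Q.map s'), e₂, ← Functor.map_comp]
  rw [MorphismProperty.map_eq_iff_precomp (cartesianMorphisms K).Q (cartesianMorphisms K)]
  have := K.isCofiltered_elements
  obtain ⟨X'', t, ht, hr⟩ := SliceTotal.exists_cartesian_right_eq (s' ≫ h₁) h₂
  refine ⟨_, t, ht, CommaMorphism.ext ?_ hr⟩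
  refine (cancel_mono f).1 ?_
  have w₁ := (t ≫ s' ≫ h₁).w
  rw [hr] at w₁
  exact w₁.trans (t ≫ h₂).w.symm

/-- If an object of the 2-colimit is subterminal, then it is already represented by a
monomorphism of `C`, after pulling back along some morphism of `∫ K`. -/
theorem SliceTotal.exists_cartesian_mono (X : SliceTotal K)
    [Mono (terminal.from ((cartesianMorphisms K).Q.obj X))] :
    ∃ (x y : C) (f : y ⟶ x) (a : K.obj x) (s : SliceTotal.mk f a ⟶ X), Mono f ∧
      cartesianMorphisms K s := by
  obtain ⟨y, ⟨x, a⟩, f⟩ := X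
  change y ⟶ x at f
  -- the kernel pair of `f` becomes trivial in the 2-colimit, hence at some later stage
  let p₁ : SliceTotal.mk (pullback.fst f f ≫ f) a ⟶ SliceTotal.mk f a :=
    SliceTotal.homMk (pullback.fst f f) (𝟙 _) (by simp) (by simp)
  let p₂ : SliceTotal.mk (pullback.fst f f ≫ f) a ⟶ SliceTotal.mk f a :=
    SliceTotal.homMk (pullback.snd f f) (𝟙 _) (by simp)
    (by simp [pullback.condition])
  have hp : (cartesianMorphisms K).Q.map p₁ = (cartesianMorphisms K).Q.map p₂ :=
    (cancel_mono (terminal.from ((cartesianMorphisms K).Q.obj (SliceTotal.mk f a)))).1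
      (terminal.hom_ext _ _)
  rw [MorphismProperty.map_eq_iff_precomp (cartesianMorphisms K).Q (cartesianMorphisms K)] at hp
  obtain ⟨X', t, ht, e⟩ := hp
  have e' : t.left ≫ pullback.fst f f = t.left ≫ pullback.snd f f := congrArg CommaMorphism.left e
  let g : X'.right.1 ⟶ x := t.right.1
  refine ⟨X'.right.1, _, pullback.snd f g, X'.right.2, SliceTotal.homMk (pullback.fst f g) g
    t.right.2 pullback.condition, ⟨fun {W} a b hab => ?_⟩, IsPullback.of_hasPullback f g⟩
  have h₁ : (a ≫ pullback.fst f g) ≫ f = (b ≫ pullback.fst f g) ≫ f := by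
    simp only [Category.assoc, pullback.condition]
    rw [← Category.assoc, hab, Category.assoc]
  have ht' : IsPullback t.left (show X'.left ⟶ X'.right.1 from X'.hom) (pullback.fst f f ≫ f) g :=
    ht
  have w : pullback.lift _ _ h₁ ≫ pullback.fst f f ≫ f = (a ≫ pullback.snd f g) ≫ g := by
    rw [pullback.lift_fst_assoc, Category.assoc, Category.assoc, pullback.condition]
  have h₂ := ht'.lift_fst _ _ w
  refine pullback.hom_ext ?_ hab
  rw [← pullback.lift_fst _ _ h₁, ← h₂, Category.assoc, e', ← Category.assoc, h₂,
    pullback.lift_snd]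

theorem CategoryTheory.Subobject.mk_terminal_from_le_iff {D : Type*} [Category D] [HasTerminal D] {A B : D}
    [Mono (terminal.from A)] [Mono (terminal.from B)] :
    Subobject.mk (terminal.from A) ≤ Subobject.mk (terminal.from B) ↔ Nonempty (A ⟶ B) :=
  ⟨fun h => ⟨Subobject.ofMkLEMk _ _ h⟩, fun ⟨h⟩ => Subobject.mk_le_mk_of_comm h
    (terminal.hom_ext _ _)⟩

/-- The subobject `[u ↪ x^a]` of the terminal object of the 2-colimit. -/
noncomputable def subobjectClass {x : C} (u : Subobject x) (a : K.obj x) :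
    Subobject (⊤_ (SliceColimit K)) :=
  Subobject.mk (terminal.from (SliceColimit.mk u.arrow a))

theorem isClassOf_iff {y x : C} (f : y ⟶ x) [Mono f] (a : K.obj x)
    (p : Subobject (⊤_ (SliceColimit K))) :
    IsClassOf p f a ↔ p = subobjectClass (Subobject.mk f) a := by
  have : subobjectClass (Subobject.mk f) a = Subobject.mk (terminal.from (SliceColimit.mk f a)) := by
    apply le_antisymm <;> apply Subobject.mk_terminal_from_le_iff.2
    · exact ⟨(cartesianMorphisms K).Q.map
        (SliceTotal.homMk (Subobject.underlyingIso f).hom (𝟙 _) (by simp) (by simp))⟩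
    · exact ⟨(cartesianMorphisms K).Q.map
        (SliceTotal.homMk (Subobject.underlyingIso f).inv (𝟙 _) (by simp) (by simp))⟩
  rw [this]
  exact ⟨fun ⟨_, h⟩ => h, fun h => ⟨inferInstance, h⟩⟩

theorem isClassOf_arrow_iff {x : C} (u : Subobject x) (a : K.obj x)
    (p : Subobject (⊤_ (SliceColimit K))) :
    IsClassOf p u.arrow a ↔ p = subobjectClass u a := by
  rw [isClassOf_iff, Subobject.mk_arrow]

theorem exists_eq_subobjectClass (p : Subobject (⊤_ (SliceColimit K))) :
    ∃ (x : C) (a : K.obj x) (u : Subobject x), p = subobjectClass u a := by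
  let Q := (cartesianMorphisms K).Q
  let e := Q.objObjPreimageIso (p : SliceColimit K)
  have h₀ : Mono (terminal.from (Q.obj (Q.objPreimage (p : SliceColimit K)))) := by
    rw [show terminal.from (Q.obj (Q.objPreimage (p : SliceColimit K))) = e.hom ≫ p.arrow from
      terminal.hom_ext _ _]
    infer_instance
  obtain ⟨x, y, f, a, s, hf, hs⟩ := SliceTotal.exists_cartesian_mono
    (Q.objPreimage (p : SliceColimit K))
  have : IsIso (Q.map s) := Localization.inverts Q (cartesianMorphisms K) s hs
  refine ⟨x, a, Subobject.mk f, (isClassOf_iff f a p).1 ⟨inferInstance, ?_⟩⟩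
  exact Subobject.eq_mk_of_comm _ (e.symm ≪≫ (asIso (Q.map s)).symm) (terminal.hom_ext _ _)

theorem subobjectClass_pullback {x z : C} (f : z ⟶ x) (u : Subobject x) (r : K.obj z) :
    subobjectClass ((Subobject.pullback f).obj u) r = subobjectClass u (K.map f r) := by
  let s : SliceTotal.mk ((Subobject.pullback f).obj u).arrow r ⟶
      SliceTotal.mk u.arrow (K.map f r) :=
    SliceTotal.homMk (Subobject.pullbackπ f u) f rfl (Subobject.isPullback f u).w
  have : IsIso ((cartesianMorphisms K).Q.map s) :=
    Localization.inverts (cartesianMorphisms K).Q (cartesianMorphisms K) s (Subobject.isPullback f u)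
  let i := asIso ((cartesianMorphisms K).Q.map s)
  exact Subobject.mk_eq_mk_of_comm _ _ i (terminal.hom_ext _ _)

theorem subobjectClass_mono {x : C} {u v : Subobject x} (h : u ≤ v) (r : K.obj x) :
    subobjectClass u r ≤ subobjectClass v r :=
  Subobject.mk_terminal_from_le_iff.2 ⟨(cartesianMorphisms K).Q.map
    (SliceTotal.homMk (Subobject.ofLE _ _ h) (𝟙 _) (by simp) (by simp))⟩

theorem subobjectClass_le_iff {x y : C} (u : Subobject x) (v : Subobject y) (s : K.obj x)
    (t : K.obj y) :
    subobjectClass u s ≤ subobjectClass v t ↔ ∃ (z : C) (r : K.obj z) (f : z ⟶ x) (g : z ⟶ y),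
      K.map f r = s ∧ K.map g r = t ∧
        (Subobject.pullback f).obj u ≤ (Subobject.pullback g).obj v := by
  constructor
  · intro h
    obtain ⟨φ⟩ := Subobject.mk_terminal_from_le_iff.1 h
    obtain ⟨X', m, n, hm, -⟩ := SliceColimit.exists_map_eq (X := SliceTotal.mk u.arrow s)
      (Y := SliceTotal.mk v.arrow t) φ
    refine ⟨X'.right.1, X'.right.2, m.right.1, n.right.1, m.right.2, n.right.2, ?_⟩
    rw [Subobject.le_pullback_iff]
    have hm' : IsPullback m.left (show X'.left ⟶ X'.right.1 from X'.hom) u.arrow m.right.1 := hm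
    have hn : n.left ≫ v.arrow = (show X'.left ⟶ X'.right.1 from X'.hom) ≫ n.right.1 := n.w
    rw [← hm'.lift_snd _ _ (Subobject.isPullback m.right.1 u).w, Category.assoc, ← hn,
      ← Category.assoc]
    exact Subobject.factors_comp_arrow _
  · rintro ⟨z, r, f, g, rfl, rfl, h⟩
    rw [← subobjectClass_pullback, ← subobjectClass_pullback]
    exact subobjectClass_mono h r

/-- Over the same element, the order on classes can be tested after a single reindexing. -/
theorem subobjectClass_le_iff' {x : C} (u v : Subobject x) (s : K.obj x) :
    subobjectClass u s ≤ subobjectClass v s ↔ ∃ (z : C) (r : K.obj z) (f : z ⟶ x),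
      K.map f r = s ∧ (Subobject.pullback f).obj u ≤ (Subobject.pullback f).obj v := by
  constructor
  · rw [subobjectClass_le_iff]
    rintro ⟨z, r, f, g, hf, hg, h⟩
    have := K.isCofiltered_elements
    let f' : K.elementsMk z r ⟶ K.elementsMk x s := ⟨f, hf⟩
    let g' : K.elementsMk z r ⟶ K.elementsMk x s := ⟨g, hg⟩
    let e := IsCofiltered.eqHom f' g'
    have he : e.1 ≫ f = e.1 ≫ g := congrArg Subtype.val (IsCofiltered.eq_condition f' g')
    refine ⟨(IsCofiltered.eq f' g').1, (IsCofiltered.eq f' g').2, e.1 ≫ f, (e ≫ f').2, ?_⟩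
    conv_rhs => rw [he]
    rw [Subobject.pullback_comp, Subobject.pullback_comp]
    exact (Subobject.pullback e.1).monotone h
  · rintro ⟨z, r, f, hf, h⟩
    exact (subobjectClass_le_iff _ _ _ _).2 ⟨z, r, f, f, hf, hf, h⟩

theorem exists_common_refinement {x y : C} (s : K.obj x) (t : K.obj y) :
    ∃ (z : C) (r : K.obj z) (f : z ⟶ x) (g : z ⟶ y), K.map f r = s ∧ K.map g r = t := by
  have := K.isCofiltered_elements
  obtain ⟨e, f, g, -⟩ := IsCofilteredOrEmpty.cone_objs (K.elementsMk x s) (K.elementsMk y t)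
  exact ⟨e.1, e.2, f.1, g.1, f.2, g.2⟩

end SubterminalObjects

/-! ### Complemented subobjects of the terminal object of the 2-colimit -/

section ComplementedClasses

variable {C : Type u} [SmallCategory C] {K : C ⥤ Type u} [HasFiniteLimits C]
  [PreservesFiniteLimits K] {lam κ : Cardinal.{u}}

/-- Every subobject of the terminal object is represented over some refinement of a given marking
element. -/
theorem exists_refinement {x : C} (s : K.obj x) (p : Subobject (⊤_ (SliceColimit K))) :
    ∃ (z : C) (r : K.obj z) (f : z ⟶ x) (w : Subobject z), K.map f r = s ∧
      p = subobjectClass w r := by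
  obtain ⟨y, t, w, rfl⟩ := exists_eq_subobjectClass p
  obtain ⟨z, r, f, g, hf, rfl⟩ := exists_common_refinement s t
  exact ⟨z, r, f, (Subobject.pullback g).obj w, hf, (subobjectClass_pullback g w r).symm⟩

theorem isTop_subobjectClass_top {x : C} (s : K.obj x) :
    IsTop (subobjectClass (⊤ : Subobject x) s) := by
  intro p
  obtain ⟨z, r, f, w, rfl, rfl⟩ := exists_refinement s p
  rw [← subobjectClass_pullback, Subobject.pullback_top]
  exact subobjectClass_mono le_top r

theorem isBot_subobjectClass {x : C} (s : K.obj x) {c : Subobject x}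
    (hc : ∀ {Y : C} (f : Y ⟶ x), IsBot ((Subobject.pullback f).obj c)) :
    IsBot (subobjectClass c s) := by
  intro p
  obtain ⟨z, r, f, w, rfl, rfl⟩ := exists_refinement s p
  rw [← subobjectClass_pullback]
  exact subobjectClass_mono (hc f w) r

theorem isGLB_subobjectClass {x : C} (a b : Subobject x) (s : K.obj x) :
    IsGLB {subobjectClass a s, subobjectClass b s} (subobjectClass (a ⊓ b) s) := by
  constructor
  · rintro _ (rfl | rfl)
    · exact subobjectClass_mono inf_le_left s
    · exact subobjectClass_mono inf_le_right s
  · intro p hp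
    have ha := hp (Set.mem_insert _ _)
    have hb := hp (Set.mem_insert_of_mem _ rfl)
    obtain ⟨z, r, f, w, rfl, rfl⟩ := exists_refinement s p
    rw [← subobjectClass_pullback] at ha hb ⊢
    obtain ⟨z', r', g, rfl, ha'⟩ := (subobjectClass_le_iff' _ _ _).1 ha
    rw [← subobjectClass_pullback, ← subobjectClass_pullback] at hb ⊢
    obtain ⟨z'', r'', h, rfl, hb'⟩ := (subobjectClass_le_iff' _ _ _).1 hb
    rw [← subobjectClass_pullback, ← subobjectClass_pullback]
    refine subobjectClass_mono ?_ r''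
    rw [Subobject.inf_pullback, Subobject.inf_pullback, Subobject.inf_pullback]
    exact le_inf ((Subobject.pullback h).monotone ha') hb'

theorem isLUB_subobjectClass {x : C} {a b d : Subobject x} (s : K.obj x) (ha : a ≤ d)
    (hb : b ≤ d) (hd : ∀ {Y : C} (f : Y ⟶ x) (r : Subobject Y),
      (Subobject.pullback f).obj a ≤ r → (Subobject.pullback f).obj b ≤ r →
        (Subobject.pullback f).obj d ≤ r) :
    IsLUB {subobjectClass a s, subobjectClass b s} (subobjectClass d s) := by
  constructor
  · rintro _ (rfl | rfl)
    · exact subobjectClass_mono ha s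
    · exact subobjectClass_mono hb s
  · intro p hp
    have ha := hp (Set.mem_insert _ _)
    have hb := hp (Set.mem_insert_of_mem _ rfl)
    obtain ⟨z, r, f, w, rfl, rfl⟩ := exists_refinement s p
    rw [← subobjectClass_pullback] at ha hb ⊢
    obtain ⟨z', r', g, rfl, ha'⟩ := (subobjectClass_le_iff' _ _ _).1 ha
    rw [← subobjectClass_pullback, ← subobjectClass_pullback] at hb ⊢
    obtain ⟨z'', r'', h, rfl, hb'⟩ := (subobjectClass_le_iff' _ _ _).1 hb
    rw [← subobjectClass_pullback, ← subobjectClass_pullback]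
    refine subobjectClass_mono ?_ r''
    rw [← Subobject.pullback_comp, ← Subobject.pullback_comp]
    apply hd <;> rw [Subobject.pullback_comp, Subobject.pullback_comp]
    · exact (Subobject.pullback h).monotone ha'
    · exact hb'

theorem areComplements_subobjectClass (hC : IsCoherentCategory lam κ C) (hlam : ℵ₀ ≤ lam)
    {x : C} {u v : Subobject x} (h : AreComplements u v) (s : K.obj x) :
    AreComplements (subobjectClass u s) (subobjectClass v s) := by
  constructor
  · intro p hu hv
    obtain ⟨c, hc⟩ := hC.exists_stable_bot hlam x
    have h₁ : p ≤ subobjectClass (u ⊓ v) s :=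
      (isGLB_subobjectClass u v s).2 (by rintro _ (rfl | rfl) <;> assumption)
    have h₂ : u ⊓ v ≤ c := h.1 _ inf_le_left inf_le_right c
    intro q
    exact (h₁.trans (subobjectClass_mono h₂ s)).trans (isBot_subobjectClass s hc q)
  · intro p hu hv
    obtain ⟨d, hd₁, hd₂, hd⟩ := hC.exists_stable_sup hlam u v
    have h₁ : subobjectClass d s ≤ p :=
      (isLUB_subobjectClass s hd₁ hd₂ hd).2 (by rintro _ (rfl | rfl) <;> assumption)
    have h₂ : ⊤ ≤ d := h.2 _ hd₁ hd₂ ⊤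
    intro q
    exact (isTop_subobjectClass_top s q).trans ((subobjectClass_mono h₂ s).trans h₁)

/-- Complementarity of two subobjects of the terminal object is witnessed at a finite stage,
since it amounts to an inequality for the meet and one for the join. -/
theorem exists_areComplements_eq_subobjectClass (hC : IsCoherentCategory lam κ C)
    (hlam : ℵ₀ ≤ lam) {p q : Subobject (⊤_ (SliceColimit K))} (h : AreComplements p q) :
    ∃ (x : C) (s : K.obj x) (u v : Subobject x), AreComplements u v ∧
      p = subobjectClass u s ∧ q = subobjectClass v s := by
  obtain ⟨x, s, u, rfl⟩ := exists_eq_subobjectClass p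
  obtain ⟨y, t, f, v, rfl, rfl⟩ := exists_refinement s q
  rw [← subobjectClass_pullback] at h ⊢
  generalize (Subobject.pullback f).obj u = u' at h ⊢
  obtain ⟨c, hc⟩ := hC.exists_stable_bot hlam y
  have h₁ := h.1 (subobjectClass (u' ⊓ v) t) (subobjectClass_mono inf_le_left t)
    (subobjectClass_mono inf_le_right t) (subobjectClass c t)
  obtain ⟨z, r, g, rfl, h₁'⟩ := (subobjectClass_le_iff' _ _ _).1 h₁
  obtain ⟨d, hd₁, hd₂, hd⟩ := hC.exists_stable_sup hlam u' v
  have h₂ := h.2 (subobjectClass d (K.map g r)) (subobjectClass_mono hd₁ _)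
    (subobjectClass_mono hd₂ _) (subobjectClass ⊤ (K.map g r))
  rw [← subobjectClass_pullback, ← subobjectClass_pullback] at h₂
  obtain ⟨z', r', k, rfl, h₂'⟩ := (subobjectClass_le_iff' _ _ _).1 h₂
  refine ⟨z', r', (Subobject.pullback (k ≫ g)).obj u', (Subobject.pullback (k ≫ g)).obj v,
    ⟨fun w hw₁ hw₂ w' => ?_, fun w hw₁ hw₂ w' => ?_⟩, ?_, ?_⟩
  · refine le_trans ?_ (hc (k ≫ g) w')
    refine (le_inf hw₁ hw₂).trans ?_
    rw [← Subobject.inf_pullback, Subobject.pullback_comp, Subobject.pullback_comp]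
    exact (Subobject.pullback k).monotone h₁'
  · refine le_trans ?_ (hd (k ≫ g) w hw₁ hw₂)
    rw [Subobject.pullback_top, Subobject.pullback_top] at h₂'
    rw [Subobject.pullback_comp]
    exact le_top.trans h₂'
  all_goals
    rw [subobjectClass_pullback, K.map_comp]
    rfl

end ComplementedClasses

/-! ### Unions of subsheaves -/

section SubSheaves

variable {D : Type u} [Category.{v} D] {J : GrothendieckTopology D}

/-- A section of a union of subsheaves locally belongs to one of them. -/
theorem IsUnion.exists_cover {ι : Type*} {F V : Sheaf J (Type w)} {U : ι → Sheaf J (Type w)}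
    {m : ∀ i, U i ⟶ F} {n : V ⟶ F} (hn : IsUnion m n) {c : D} (s : V.obj.obj (op c)) :
    ∃ S ∈ J c, ∀ ⦃d : D⦄ (g : d ⟶ c), S g →
      ∃ i, F.obj.map g.op (n.hom.app (op c) s) ∈ Set.range ((m i).hom.app (op d)) := by
  let G : Subfunctor F.obj := ⨆ i, Subfunctor.range (m i).hom
  let F' : Sheaf J (Type w) := ⟨(G.sheafify J).toFunctor,
    (isSheaf_iff_isSheaf_of_type _ _).2
      (G.sheafify_isSheaf ((isSheaf_iff_isSheaf_of_type _ _).1 F.2))⟩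
  let p : F' ⟶ F := ⟨(G.sheafify J).ι⟩
  have : Mono p := (sheafToPresheaf J _).mono_of_mono_map
    (inferInstanceAs (Mono (G.sheafify J).ι))
  obtain ⟨k, rfl⟩ := hn.least p (fun i => ⟨⟨Subfunctor.lift (m i).hom
    ((le_iSup (fun i => Subfunctor.range (m i).hom) i).trans (G.le_sheafify J))⟩, rfl⟩)
  refine ⟨_, (k.hom.app (op c) s).2, fun d g hg => ?_⟩
  have hg' : F.obj.map g.op (k.hom.app (op c) s).1 ∈ G.obj (op d) := hg
  rw [Subfunctor.iSup_obj, Set.mem_iUnion] at hg'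
  exact hg'

/-- The sections of a subsheaf are determined locally. -/
theorem CategoryTheory.Sheaf.mem_range_of_cover {F G : Sheaf J (Type w)} (m : G ⟶ F) [Mono m]
    {c : D} (s : F.obj.obj (op c)) {S : Sieve c} (hS : S ∈ J c)
    (h : ∀ ⦃d : D⦄ (g : d ⟶ c), S g → F.obj.map g.op s ∈ Set.range (m.hom.app (op d))) :
    s ∈ Set.range (m.hom.app (op c)) := by
  have : Mono m.hom := inferInstanceAs (Mono ((sheafToPresheaf J _).map m))
  have hG : Presieve.IsSheaf J (Subfunctor.range m.hom).toFunctor :=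
    (isSheaf_iff_isSheaf_of_type _ _).1
      ((Presheaf.isSheaf_of_iso_iff (asIso (Subfunctor.toRange m.hom))).1 G.2)
  exact (Subfunctor.isSheaf_iff _ ((isSheaf_iff_isSheaf_of_type _ _).1 F.2)).1 hG _ s
    (J.superset_covering (fun d g hg => h g hg) hS)

end SubSheaves

/-! ### Sections of the images of subobjects under a coherent functor -/

theorem IsLexFunctor.preservesFiniteLimits {C : Type w} [Category.{v} C] {D : Type w'}
    [Category.{v'} D] {κ : Cardinal.{u}} {F : C ⥤ D} (h : IsLexFunctor κ F) (hκ : ℵ₀ ≤ κ) :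
    PreservesFiniteLimits F where
  preservesFiniteLimits J _ _ := by
    have e : Arrow (ULiftHom.{u} (ULift.{u} J)) ≃
        Σ (a b : ULiftHom.{u} (ULift.{u} J)), (a ⟶ b) :=
      { toFun := fun f => ⟨f.left, f.right, f.hom⟩
        invFun := fun x => Arrow.mk x.2.2 }
    have : FinCategory (ULiftHom.{u} (ULift.{u} J)) := inferInstance
    have : Finite (Arrow (ULiftHom.{u} (ULift.{u} J))) := Finite.of_equiv _ e.symm
    have := h (ULiftHom.{u} (ULift.{u} J)) (hasCardinalLT_of_finite _ _ hκ)
    exact preservesLimitsOfShape_of_equiv (ULiftHomULiftCategory.equiv.{u, u} J).symm F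

section RangesOfSubobjects

variable {C : Type w} [Category.{v} C] (F : C ⥤ Type u)

theorem mem_range_map_of_le {x : C} {u v : Subobject x} (h : u ≤ v) {t : F.obj x}
    (ht : t ∈ Set.range (F.map u.arrow)) : t ∈ Set.range (F.map v.arrow) := by
  obtain ⟨a, rfl⟩ := ht
  exact ⟨F.map (Subobject.ofLE u v h) a, by
    rw [← ConcreteCategory.comp_apply, ← F.map_comp, Subobject.ofLE_arrow]⟩

theorem range_map_mk_arrow {x y : C} (i : y ⟶ x) [Mono i] :
    Set.range (F.map (Subobject.mk i).arrow) = Set.range (F.map i) := by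
  ext t
  constructor
  · rintro ⟨a, rfl⟩
    exact ⟨F.map (Subobject.underlyingIso i).hom a, by
      rw [← ConcreteCategory.comp_apply, ← F.map_comp, Subobject.underlyingIso_hom_comp_eq_mk]⟩
  · rintro ⟨a, rfl⟩
    exact ⟨F.map (Subobject.underlyingIso i).inv a, by
      rw [← ConcreteCategory.comp_apply, ← F.map_comp, Subobject.underlyingIso_arrow]⟩

variable [HasPullbacks C] [PreservesLimitsOfShape WalkingCospan F]

theorem mem_range_map_pullback_iff {x z : C} (f : z ⟶ x) (u : Subobject x) (r : F.obj z) :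
    r ∈ Set.range (F.map ((Subobject.pullback f).obj u).arrow) ↔
      F.map f r ∈ Set.range (F.map u.arrow) := by
  have h := (Subobject.isPullback f u).map F
  constructor
  · rintro ⟨a, rfl⟩
    exact ⟨F.map (Subobject.pullbackπ f u) a, ConcreteCategory.congr_hom h.w a⟩
  · rintro ⟨a, ha⟩
    obtain ⟨b, -, hb⟩ := Types.exists_of_isPullback h a r ha
    exact ⟨b, hb⟩

theorem mem_range_map_inf {x : C} {u v : Subobject x} {t : F.obj x}
    (hu : t ∈ Set.range (F.map u.arrow)) (hv : t ∈ Set.range (F.map v.arrow)) :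
    t ∈ Set.range (F.map (u ⊓ v).arrow) := by
  obtain ⟨a, rfl⟩ := hu
  obtain ⟨b, hb⟩ := hv
  obtain ⟨c, hc, -⟩ := Types.exists_of_isPullback ((Subobject.inf_isPullback u v).map F) a b hb.symm
  refine ⟨c, ?_⟩
  rw [← hc, ← ConcreteCategory.comp_apply, ← F.map_comp, Subobject.ofLE_arrow]

end RangesOfSubobjects

theorem IsCoherentCategory.exists_isLUB {lam κ : Cardinal.{u}} {B : Type u} [BooleanAlgebra B]
    (hB : IsCoherentCategory lam κ B) {ι : Type u} (f : ι → B) (hι : HasCardinalLT ι lam) :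
    ∃ b, IsLUB (Set.range f) b := by
  have (i : ι) : Mono (homOfLE le_top : f i ⟶ ⊤) := ⟨fun _ _ _ => Subsingleton.elim _ _⟩
  obtain ⟨b, n, hn⟩ := hB.exists_union (fun i => (homOfLE le_top : f i ⟶ ⊤)) hι
  refine ⟨b, ?_, fun c hc => ?_⟩
  · rintro _ ⟨i, rfl⟩
    exact leOfHom (hn.factors i).choose
  · have : Mono (homOfLE le_top : c ⟶ ⊤) := ⟨fun _ _ _ => Subsingleton.elim _ _⟩
    exact leOfHom (hn.least (homOfLE le_top : c ⟶ ⊤)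
      (fun i => ⟨homOfLE (hc ⟨i, rfl⟩), Subsingleton.elim _ _⟩)).choose

section Sections

variable {B : Type u} [BooleanAlgebra B] {C : Type u} [SmallCategory C] {κ : Cardinal.{u}}
  {hκ : κ.IsRegular}

/-- The functor of sections of `N` over `b`. -/
def sectionsAt {J : GrothendieckTopology B} (N : C ⥤ Sheaf J (Type u)) (b : B) : C ⥤ Type u :=
  N ⋙ sheafToPresheaf J (Type u) ⋙ (evaluation Bᵒᵖ (Type u)).obj (op b)

instance {J : GrothendieckTopology B} (N : C ⥤ Sheaf J (Type u)) [PreservesFiniteLimits N] (b : B) :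
    PreservesFiniteLimits (sectionsAt N b) := by
  unfold sectionsAt
  infer_instance

instance {J : GrothendieckTopology B} (N : C ⥤ Sheaf J (Type u)) [PreservesFiniteLimits N] :
    PreservesFiniteLimits (globalSections N) := by
  unfold globalSections
  infer_instance

/-- The restriction of the global section `s` to `b`. -/
def restrictTo {J : GrothendieckTopology B} (N : C ⥤ Sheaf J (Type u)) {x : C}
    (s : (globalSections N).obj x) (b : B) : (sectionsAt N b).obj x :=
  (N.obj x).obj.map (homOfLE le_top : b ⟶ ⊤).op s

/-- The restriction of `s` to `b` is a section of the subobject `N u` of `N x`. -/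
def LiesIn {J : GrothendieckTopology B} (N : C ⥤ Sheaf J (Type u)) {x : C} (u : Subobject x)
    (s : (globalSections N).obj x) (b : B) : Prop :=
  restrictTo N s b ∈ Set.range ((sectionsAt N b).map u.arrow)

theorem isSplitBy_iff {J : GrothendieckTopology B} (N : C ⥤ Sheaf J (Type u)) {x : C}
    (u v : Subobject x) (s : (globalSections N).obj x) (b : B) :
    IsSplitBy N u.arrow v.arrow s b ↔ LiesIn N u s b ∧ LiesIn N v s bᶜ :=
  Iff.rfl

theorem isSplitBy_mk_iff {J : GrothendieckTopology B} (N : C ⥤ Sheaf J (Type u)) {x y z : C}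
    (i : y ⟶ x) (j : z ⟶ x) [Mono i] [Mono j] (s : (globalSections N).obj x) (b : B) :
    IsSplitBy N (Subobject.mk i).arrow (Subobject.mk j).arrow s b ↔ IsSplitBy N i j s b := by
  rw [isSplitBy_iff]
  unfold LiesIn
  rw [range_map_mk_arrow, range_map_mk_arrow]
  rfl

section

variable {J : GrothendieckTopology B} {N : C ⥤ Sheaf J (Type u)}

theorem restrictTo_map {x z : C} (f : z ⟶ x) (r : (globalSections N).obj z) (b : B) :
    restrictTo N ((globalSections N).map f r) b = (sectionsAt N b).map f (restrictTo N r b) :=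
  (NatTrans.naturality_apply (N.map f).hom (homOfLE le_top : b ⟶ ⊤).op r).symm

theorem map_restrictTo {x : C} (s : (globalSections N).obj x) {b c : B} (g : c ⟶ b) :
    (N.obj x).obj.map g.op (restrictTo N s b) = restrictTo N s c :=
  (ConcreteCategory.congr_hom ((N.obj x).obj.map_comp (homOfLE le_top : b ⟶ ⊤).op g.op)
    s).symm

theorem LiesIn.mono_left {x : C} {u v : Subobject x} (h : u ≤ v) {s : (globalSections N).obj x}
    {b : B} (hu : LiesIn N u s b) : LiesIn N v s b :=
  mem_range_map_of_le _ h hu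

theorem LiesIn.mono_right {x : C} {u : Subobject x} {s : (globalSections N).obj x}
    {b c : B} (h : c ≤ b) (hb : LiesIn N u s b) : LiesIn N u s c := by
  obtain ⟨a, ha⟩ := hb
  refine ⟨(N.obj _).obj.map (homOfLE h).op a, ?_⟩
  rw [← map_restrictTo s (homOfLE h), ← ha]
  exact NatTrans.naturality_apply (N.map u.arrow).hom (homOfLE h).op a

variable [HasFiniteLimits C] [PreservesFiniteLimits N]

theorem liesIn_pullback_iff {x z : C} (f : z ⟶ x) (u : Subobject x)
    (r : (globalSections N).obj z) (b : B) :
    LiesIn N ((Subobject.pullback f).obj u) r b ↔ LiesIn N u ((globalSections N).map f r) b := by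
  unfold LiesIn
  rw [mem_range_map_pullback_iff, restrictTo_map]

theorem LiesIn.inf {x : C} {u v : Subobject x} {s : (globalSections N).obj x} {b : B}
    (hu : LiesIn N u s b) (hv : LiesIn N v s b) : LiesIn N (u ⊓ v) s b :=
  mem_range_map_inf _ hu hv

end

variable {N : C ⥤ Sheaf (unionTopology hκ B) (Type u)}

section

variable [PreservesFiniteLimits N]

theorem LiesIn.of_isLUB {x : C} {u : Subobject x} {s : (globalSections N).obj x} {ι : Type u}
    (hι : HasCardinalLT ι κ) {f : ι → B} {b : B} (hb : IsLUB (Set.range f) b)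
    (h : ∀ i, LiesIn N u s (f i)) : LiesIn N u s b := by
  let S : Sieve b :=
    { arrows := fun c _ => LiesIn N u s c
      downward_closed := fun hc g => hc.mono_right (leOfHom g) }
  have hS : S ∈ unionTopology hκ B b :=
    ⟨ι, f, hι, fun i => ⟨homOfLE (hb.1 ⟨i, rfl⟩), h i⟩, hb⟩
  refine Sheaf.mem_range_of_cover (N.map u.arrow) (restrictTo N s b) hS fun c g hg => ?_
  rw [map_restrictTo s g]
  exact hg

theorem LiesIn.sup {x : C} {u : Subobject x} {s : (globalSections N).obj x}
    {b c : B} (hb : LiesIn N u s b) (hc : LiesIn N u s c) : LiesIn N u s (b ⊔ c) := by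
  refine LiesIn.of_isLUB (ι := ULift.{u} Bool) (hasCardinalLT_of_finite _ _ hκ.1)
    (f := fun i => if i.down then b else c) ⟨?_, fun d hd => ?_⟩ ?_
  · rintro _ ⟨⟨_ | _⟩, rfl⟩
    · exact le_sup_right
    · exact le_sup_left
  · exact sup_le (hd ⟨⟨true⟩, rfl⟩) (hd ⟨⟨false⟩, rfl⟩)
  · rintro ⟨_ | _⟩
    · exact hc
    · exact hb

end

theorem LiesIn.eq_bot {x : C} (hN : IsCoherentFunctor κ κ N) {u : Subobject x} (hu : IsBot u)
    {s : (globalSections N).obj x} {b : B} (hb : LiesIn N u s b) : b = ⊥ := by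
  let U : PEmpty.{u + 1} → C := PEmpty.elim
  have : ∀ i, Mono ((PEmpty.elim i : U i ⟶ x)) := fun i => i.elim
  -- a least subobject is the union of the empty family
  have h : IsUnion (fun i => (PEmpty.elim i : U i ⟶ x)) u.arrow :=
    { mono := inferInstance
      factors := fun i => i.elim
      least := fun p _ _ => ⟨Subobject.ofLEMk _ p (hu _), Subobject.ofLEMk_comp _⟩ }
  obtain ⟨t, -⟩ := hb
  obtain ⟨S, ⟨ι, f, -, hf, hS⟩, hS'⟩ :=
    (hN.isUnion _ _ (hasCardinalLT_of_finite _ _ hκ.1) h).exists_cover t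
  refine le_bot_iff.1 (hS.2 ?_)
  rintro _ ⟨i, rfl⟩
  obtain ⟨g, hg⟩ := hf i
  exact (hS' g hg).choose.elim

/-- If `u` and `v` cover `x`, then each global section of `N x` lies locally in `N u` or in
`N v`. -/
theorem exists_cover_liesIn (hN : IsCoherentFunctor κ κ N) {x : C} {u v : Subobject x}
    (huv : ∀ r, u ≤ r → v ≤ r → IsTop r) (s : (globalSections N).obj x) :
    ∃ (ι : Type u) (f : ι → B), HasCardinalLT ι κ ∧ IsLUB (Set.range f) ⊤ ∧
      ∀ i, LiesIn N u s (f i) ∨ LiesIn N v s (f i) := by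
  let U : ULift.{u} Bool → Subobject x := fun i => if i.down then u else v
  have h : IsUnion (fun i => (U i).arrow) (𝟙 x) :=
    { mono := inferInstance
      factors := fun i => ⟨(U i).arrow, Category.comp_id _⟩
      least := fun p _ hp => by
        have le (i) : U i ≤ Subobject.mk p :=
          Subobject.le_mk_of_comm (hp i).choose (hp i).choose_spec
        exact ⟨Subobject.ofMkLEMk _ _ (huv _ (le ⟨true⟩) (le ⟨false⟩) (Subobject.mk (𝟙 x))),
          Subobject.ofMkLEMk_comp _⟩ }
  obtain ⟨S, ⟨ι, f, hι, hf, hS⟩, hS'⟩ :=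
    (hN.isUnion _ _ (hasCardinalLT_of_finite _ _ hκ.1) h).exists_cover (c := (⊤ : B)) s
  refine ⟨ι, f, hι, hS, fun i => ?_⟩
  obtain ⟨g, hg⟩ := hf i
  obtain ⟨⟨j⟩, hj⟩ := hS' g hg
  have hj' : LiesIn N (U ⟨j⟩) s (f i) := by
    have : (N.map (𝟙 x)).hom.app (op ⊤) s = s := by
      rw [N.map_id]
      rfl
    rw [this] at hj
    exact hj
  obtain _ | _ := j
  · exact Or.inr hj'
  · exact Or.inl hj'

variable [PreservesFiniteLimits N]

/-- A global section of `N x` is split by any pair of complementary subobjects of `x`. -/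
theorem AreComplements.exists_isSplitBy (hB : IsCoherentCategory κ κ B)
    (hN : IsCoherentFunctor κ κ N) {x : C} {u v : Subobject x} (h : AreComplements u v)
    (s : (globalSections N).obj x) : ∃ b, IsSplitBy N u.arrow v.arrow s b := by
  obtain ⟨ι, f, hι, hf, hs⟩ := exists_cover_liesIn hN h.2 s
  have hι' (p : ι → Prop) : HasCardinalLT {i // p i} κ :=
    hι.of_injective _ Subtype.val_injective
  obtain ⟨b, hb⟩ := hB.exists_isLUB (fun i : {i // LiesIn N u s (f i)} => f i) (hι' _)
  obtain ⟨c, hc⟩ := hB.exists_isLUB (fun i : {i // LiesIn N v s (f i)} => f i) (hι' _)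
  have hub : LiesIn N u s b := LiesIn.of_isLUB (hι' _) hb fun i => i.2
  have hvc : LiesIn N v s c := LiesIn.of_isLUB (hι' _) hc fun i => i.2
  refine ⟨b, hub, hvc.mono_right (codisjoint_iff_compl_le_right.1 (codisjoint_iff_le_sup.2
    (hf.2 ?_)))⟩
  rintro _ ⟨i, rfl⟩
  obtain hi | hi := hs i
  · exact (hb.1 ⟨⟨i, hi⟩, rfl⟩).trans le_sup_left
  · exact (hc.1 ⟨⟨i, hi⟩, rfl⟩).trans le_sup_right

variable [HasFiniteLimits C]

theorem LiesIn.disjoint (hN : IsCoherentFunctor κ κ N) {x : C} {u v : Subobject x}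
    (h : ∀ r, r ≤ u → r ≤ v → IsBot r) {s : (globalSections N).obj x} {b c : B}
    (hb : LiesIn N u s b) (hc : LiesIn N v s c) : b ⊓ c = ⊥ :=
  ((hb.mono_right inf_le_left).inf (hc.mono_right inf_le_right)).eq_bot hN
    (h _ inf_le_left inf_le_right)

end Sections

/-! ### The order of `B` and the order of complemented classes -/

section Comparison

variable {B : Type u} [BooleanAlgebra B] {C : Type u} [SmallCategory C] {κ : Cardinal.{u}}
  {hκ : κ.IsRegular} {N : C ⥤ Sheaf (unionTopology hκ B) (Type u)}

theorem isSplitBy_compl {x : C} {u v : Subobject x} {s : (globalSections N).obj x} {b : B}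
    (h : IsSplitBy N u.arrow v.arrow s b) : IsSplitBy N v.arrow u.arrow s bᶜ := by
  rw [isSplitBy_iff] at h ⊢
  rw [compl_compl]
  exact h.symm

variable [HasFiniteLimits C] [PreservesFiniteLimits N]

theorem isSplitBy_pullback_iff {x z : C} (f : z ⟶ x) (u v : Subobject x)
    (r : (globalSections N).obj z) (b : B) :
    IsSplitBy N ((Subobject.pullback f).obj u).arrow ((Subobject.pullback f).obj v).arrow r b ↔
      IsSplitBy N u.arrow v.arrow ((globalSections N).map f r) b := by
  rw [isSplitBy_iff, isSplitBy_iff, liesIn_pullback_iff, liesIn_pullback_iff]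

/-- The elements of `B` which split two complemented subobjects are ordered as the classes of the
subobjects. If `b ≤ c`, then `s` is a global section of the join of `u'` and `v`, so that it can be
reindexed along this join, over which `u ≤ v`. -/
theorem subobjectClass_le_iff_of_isSplitBy_same (hC : IsCoherentCategory κ κ C)
    (hN : IsCoherentFunctor κ κ N) {x : C} {u u' v v' : Subobject x} (hu : AreComplements u u')
    (hv : AreComplements v v') {s : (globalSections N).obj x} {b c : B}
    (hb : IsSplitBy N u.arrow u'.arrow s b) (hc : IsSplitBy N v.arrow v'.arrow s c) :
    subobjectClass u s ≤ subobjectClass v s ↔ b ≤ c := by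
  rw [subobjectClass_le_iff']
  constructor
  · rintro ⟨z, r, f, rfl, h⟩
    rw [← isSplitBy_pullback_iff, isSplitBy_iff] at hb hc
    have := (hb.1.mono_left h).disjoint hN (hv.pullback hC hκ.1 f).1 hc.2
    exact disjoint_compl_right_iff.1 (disjoint_iff.2 this)
  · intro hbc
    rw [isSplitBy_iff] at hb hc
    obtain ⟨d, hd₁, hd₂, hd⟩ := hC.exists_stable_sup hκ.1 u' v
    have hs : LiesIn N d s (b ⊔ bᶜ) :=
      ((hc.1.mono_right hbc).mono_left hd₂).sup (hb.2.mono_left hd₁)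
    rw [sup_compl_eq_top] at hs
    obtain ⟨r, hr⟩ := hs
    have hr' : (globalSections N).map d.arrow r = s :=
      hr.trans (ConcreteCategory.congr_hom ((N.obj x).obj.map_id (op ⊤)) s)
    refine ⟨_, r, d.arrow, hr', ?_⟩
    refine Subobject.le_of_disjoint_of_codisjoint hC hκ.1 (hu.pullback hC hκ.1 d.arrow).1
      fun w h₁ h₂ w' => ?_
    refine le_trans ?_ (hd d.arrow w h₁ h₂)
    rw [Subobject.le_pullback_iff]
    exact Subobject.factors_comp_arrow _

theorem subobjectClass_le_iff_of_isSplitBy (hC : IsCoherentCategory κ κ C)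
    (hN : IsCoherentFunctor κ κ N) {x y : C} {u u' : Subobject x} {v v' : Subobject y}
    (hu : AreComplements u u') (hv : AreComplements v v') {s : (globalSections N).obj x}
    {t : (globalSections N).obj y} {b c : B}
    (hb : IsSplitBy N u.arrow u'.arrow s b) (hc : IsSplitBy N v.arrow v'.arrow t c) :
    subobjectClass u s ≤ subobjectClass v t ↔ b ≤ c := by
  obtain ⟨z, r, f, g, rfl, rfl⟩ := exists_common_refinement s t
  rw [← isSplitBy_pullback_iff] at hb hc
  rw [← subobjectClass_pullback, ← subobjectClass_pullback]
  exact subobjectClass_le_iff_of_isSplitBy_same hC hN (hu.pullback hC hκ.1 f)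
    (hv.pullback hC hκ.1 g) hb hc

end Comparison

/-! ### Coproduct injections -/

section Coproducts

variable {C : Type w} [Category.{v} C]

theorem HasSmallDisjointCoproducts.binaryCoproductDisjoint {κ : Cardinal.{u}}
    (h : HasSmallDisjointCoproducts κ C) (hκ : ℵ₀ ≤ κ) (X Y : C) : BinaryCoproductDisjoint X Y := by
  let F : ULift.{u} WalkingPair → C := fun j => j.down.casesOn X Y
  have hF : CoproductDisjoint F := h.disjoint F (hasCardinalLT_of_finite _ _ hκ)
  -- transport along the bijection between the two index types
  let G : WalkingPair → C := fun j => j.casesOn X Y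
  have hc {c : Cofan G} (hc : IsColimit c) :
      IsColimit (Cofan.mk c.pt (fun j : ULift.{u} WalkingPair => c.inj j.down) : Cofan F) :=
    let g (t : Cofan F) (j : WalkingPair) : G j ⟶ t.pt := t.inj ⟨j⟩
    Cofan.IsColimit.mk _ (fun t => Cofan.IsColimit.desc hc (g t))
      (fun t j => Cofan.IsColimit.fac hc (g t) j.down)
      (fun t m hm => Cofan.IsColimit.hom_ext hc _ _ fun j =>
        (hm ⟨j⟩).trans (Cofan.IsColimit.fac hc (g t) j).symm)
  exact
    { nonempty_isInitial_of_ne := fun {c} h i j hij s hs =>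
        hF.nonempty_isInitial_of_ne (hc h) (i := ⟨i⟩) (j := ⟨j⟩)
          (fun e => hij (congrArg ULift.down e)) s hs
      mono_inj := fun {c} h i => hF.mono_inj (hc h) ⟨i⟩ }

variable [HasFiniteCoproducts C]

theorem areComplements_coprod [HasPullbacks C] (X Y : C) [BinaryCoproductDisjoint X Y] :
    AreComplements (Subobject.mk (coprod.inl : X ⟶ X ⨿ Y))
      (Subobject.mk (coprod.inr : Y ⟶ X ⨿ Y)) := by
  constructor
  · intro r hl hr q
    let hI : IsInitial (pullback (coprod.inl : X ⟶ X ⨿ Y) coprod.inr) :=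
      IsInitial.ofBinaryCoproductDisjoint
    let k : (r : C) ⟶ pullback (coprod.inl : X ⟶ X ⨿ Y) coprod.inr :=
      pullback.lift (Subobject.ofLEMk r _ hl) (Subobject.ofLEMk r _ hr) (by simp)
    refine Subobject.le_of_comm (k ≫ hI.to _) ?_
    rw [Category.assoc, hI.hom_ext (hI.to _ ≫ q.arrow) (pullback.fst _ _ ≫ coprod.inl),
      pullback.lift_fst_assoc, Subobject.ofLEMk_comp]
  · intro r hl hr q
    refine Subobject.le_of_comm (q.arrow ≫
      coprod.desc (Subobject.ofMkLE _ r hl) (Subobject.ofMkLE _ r hr)) ?_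
    rw [Category.assoc]
    conv_rhs => rw [← Category.comp_id q.arrow]
    congr 1
    ext <;> simp

theorem subobject_mk_coprod_map_initial (X Y : C) [Mono (coprod.inl : X ⟶ X ⨿ Y)] :
    ∃ _ : Mono (coprod.map (𝟙 X) (initial.to Y)),
      Subobject.mk (coprod.map (𝟙 X) (initial.to Y)) = Subobject.mk coprod.inl := by
  have h : coprod.map (𝟙 X) (initial.to Y) = (coprod.rightUnitor X).hom ≫ coprod.inl := by
    refine coprod.hom_ext ?_ (initial.hom_ext _ _)
    simp only [coprod.inl_map, Category.id_comp, coprod.rightUnitor_hom]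
    rw [coprod.inl_desc_assoc, Category.id_comp]
  have : Mono (coprod.map (𝟙 X) (initial.to Y)) := h ▸ inferInstance
  exact ⟨this, Subobject.mk_eq_mk_of_comm _ _ (coprod.rightUnitor X) h.symm⟩

end Coproducts

/-! ### Gluing over an element of `B` and its complement -/

section Gluing

variable {B : Type u} [BooleanAlgebra B] {κ : Cardinal.{u}} {hκ : κ.IsRegular}

/-- The empty family covers the least element of `B`. -/
theorem unionTopology_subsingleton_bot (F : Sheaf (unionTopology hκ B) (Type u)) {d : B}
    (hd : d ≤ ⊥) (a b : F.obj.obj (op d)) : a = b := by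
  have hS : (⊥ : Sieve d) ∈ unionTopology hκ B d :=
    ⟨PEmpty, PEmpty.elim, hasCardinalLT_of_finite _ _ hκ.1, fun i => i.elim,
      by rintro _ ⟨i, -⟩; exact i.elim, fun z _ => hd.trans bot_le⟩
  exact (((isSheaf_iff_isSheaf_of_type _ _).1 F.2).isSeparated _ hS).ext fun _ _ h => h.elim

theorem existsUnique_glue_compl (F : Sheaf (unionTopology hκ B) (Type u)) (b : B)
    (s : F.obj.obj (op b)) (t : F.obj.obj (op bᶜ)) :
    ∃! r : F.obj.obj (op ⊤), F.obj.map (homOfLE le_top : b ⟶ ⊤).op r = s ∧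
      F.obj.map (homOfLE le_top : bᶜ ⟶ ⊤).op r = t := by
  let X : ULift.{u} Bool → B := fun i => if i.down then b else bᶜ
  let π (i) : X i ⟶ ⊤ := homOfLE le_top
  have hS : Sieve.generate (Presieve.ofArrows X π) ∈ unionTopology hκ B ⊤ := by
    refine ⟨_, X, hasCardinalLT_of_finite _ _ hκ.1, fun i => ⟨π i, Sieve.le_generate _ _ _ ⟨i⟩⟩,
      fun _ _ => le_top, fun z hz => ?_⟩
    rw [← sup_compl_eq_top (x := b)]
    exact sup_le (hz ⟨⟨true⟩, rfl⟩) (hz ⟨⟨false⟩, rfl⟩)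
  have h := (Presieve.isSheafFor_arrows_iff _ _).1 ((Presieve.isSheafFor_iff_generate _).2
    ((isSheaf_iff_isSheaf_of_type _ _).1 F.2 _ hS))
  obtain ⟨r, hr, hr'⟩ := h (fun | ⟨true⟩ => s | ⟨false⟩ => t) (by
    rintro ⟨_ | _⟩ ⟨_ | _⟩ d gi gj -
    · rw [Subsingleton.elim gi gj]
    · exact unionTopology_subsingleton_bot F
        ((le_inf (leOfHom gj) (leOfHom gi)).trans inf_compl_eq_bot.le) _ _
    · exact unionTopology_subsingleton_bot F
        ((le_inf (leOfHom gi) (leOfHom gj)).trans inf_compl_eq_bot.le) _ _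
    · rw [Subsingleton.elim gi gj])
  refine ⟨r, ⟨hr ⟨true⟩, hr ⟨false⟩⟩, fun r' hr'' => hr' _ ?_⟩
  rintro ⟨_ | _⟩
  · exact hr''.2
  · exact hr''.1

theorem existsUnique_isSplitBy_of_terminal {C : Type u} [SmallCategory C] [HasTerminal C]
    {N : C ⥤ Sheaf (unionTopology hκ B) (Type u)} [PreservesFiniteLimits N] {x : C}
    (i j : ⊤_ C ⟶ x) (b : B) : ∃! s : (globalSections N).obj x, IsSplitBy N i j s b := by
  let e (c : B) := Types.isTerminalEquivUnique _
    (terminalIsTerminal.isTerminalObj (sectionsAt N c))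
  obtain ⟨s, hs, hs'⟩ := existsUnique_glue_compl (N.obj x) b
    ((sectionsAt N b).map i (e b).default) ((sectionsAt N bᶜ).map j (e bᶜ).default)
  refine ⟨s, ⟨⟨_, hs.1.symm⟩, ⟨_, hs.2.symm⟩⟩, ?_⟩
  rintro s' ⟨⟨a, ha⟩, ⟨a', ha'⟩⟩
  refine hs' s' ⟨?_, ?_⟩
  · rw [← ha, ← (e b).uniq a]
    rfl
  · rw [← ha', ← (e bᶜ).uniq a']
    rfl

end Gluing

/-! ### The isomorphism between `B` and the complemented subobjects -/

section Isomorphism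

variable {B : Type u} [BooleanAlgebra B] {C : Type u} [SmallCategory C] {κ : Cardinal.{u}}
  {hκ : κ.IsRegular} {N : C ⥤ Sheaf (unionTopology hκ B) (Type u)} [HasFiniteLimits C]
  [PreservesFiniteLimits N]

/-- `ψ` is the inverse of the map sending a complemented subobject, represented by a complemented
`u ↪ x` and a global section `s` of `N x`, to the element of `B` which splits `s`; the element does
not depend on the representative, and it determines the subobject. -/
theorem exists_orderIso (hC : IsCoherentCategory κ κ C) (hC' : HasSmallDisjointCoproducts κ C)
    (hB : IsCoherentCategory κ κ B) (hN : IsCoherentFunctor κ κ N) :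
    ∃ ψ : B ≃o ComplementedSubobject (⊤_ (SliceColimit (globalSections N))),
      ∀ (b : B) (x : C) (s : (globalSections N).obj x) (u v : Subobject x),
        AreComplements u v → ((ψ b).1 = subobjectClass u s ↔ IsSplitBy N u.arrow v.arrow s b) := by
  have h₀ (p : ComplementedSubobject (⊤_ (SliceColimit (globalSections N)))) :
      ∃ (x : C) (s : (globalSections N).obj x) (u v : Subobject x) (b : B), AreComplements u v ∧
        p.1 = subobjectClass u s ∧ IsSplitBy N u.arrow v.arrow s b := by
    obtain ⟨p, q, hpq⟩ := p
    obtain ⟨x, s, u, v, huv, rfl, rfl⟩ := exists_areComplements_eq_subobjectClass hC hκ.1 hpq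
    obtain ⟨b, hb⟩ := huv.exists_isSplitBy hB hN s
    exact ⟨x, s, u, v, b, huv, rfl, hb⟩
  choose x s u v φ huv hp hφ using h₀
  have hle (p q) : φ p ≤ φ q ↔ p ≤ q := by
    rw [← Subtype.coe_le_coe, hp p, hp q,
      subobjectClass_le_iff_of_isSplitBy hC hN (huv p) (huv q) (hφ p) (hφ q)]
  have hspec (p) {y : C} {t : (globalSections N).obj y} {w w' : Subobject y}
      (hw : AreComplements w w') (b : B) (hb : IsSplitBy N w.arrow w'.arrow t b) :
      p.1 = subobjectClass w t ↔ φ p = b := by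
    rw [hp p, le_antisymm_iff, le_antisymm_iff,
      subobjectClass_le_iff_of_isSplitBy hC hN (huv p) hw (hφ p) hb,
      subobjectClass_le_iff_of_isSplitBy hC hN hw (huv p) hb (hφ p)]
  have hsurj : Function.Surjective φ := fun b => by
    have := hC'.hasFiniteCoproducts hκ.1
    have := hC'.binaryCoproductDisjoint hκ.1 (⊤_ C) (⊤_ C)
    have hI := areComplements_coprod (⊤_ C) (⊤_ C)
    obtain ⟨t, ht, -⟩ := existsUnique_isSplitBy_of_terminal (N := N)
      (coprod.inl : ⊤_ C ⟶ (⊤_ C) ⨿ (⊤_ C)) coprod.inr b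
    refine ⟨⟨subobjectClass (Subobject.mk coprod.inl) t, _,
      areComplements_subobjectClass hC hκ.1 hI t⟩, ?_⟩
    exact (hspec _ hI b ((isSplitBy_mk_iff N _ _ _ _).2 ht)).1 rfl
  let Φ := OrderIso.ofSurjective (OrderEmbedding.ofMapLEIff φ hle) hsurj
  refine ⟨Φ.symm, fun b y t w w' hw => ?_⟩
  have hΦ : φ (Φ.symm b) = b := Φ.apply_symm_apply b
  obtain ⟨c, hc⟩ := hw.exists_isSplitBy hB hN t
  rw [hspec _ hw c hc, hΦ]
  constructor
  · rintro rfl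
    exact hc
  · intro hb
    rw [← hΦ, ← hspec _ hw c hc, hspec _ hw b hb, hΦ]

/-- An order isomorphism onto the complemented subobjects of `1` automatically respects the
Boolean operations of the poset of all subobjects: meets and joins of complemented subobjects are
computed at a common stage, where they are again complemented. -/
theorem orderIso_preserves_boolean_operations (hC : IsCoherentCategory κ κ C)
    (ψ : B ≃o ComplementedSubobject (⊤_ (SliceColimit (globalSections N))))
    (hψ : ∀ (b : B) (x : C) (s : (globalSections N).obj x) (u v : Subobject x),
      AreComplements u v → ((ψ b).1 = subobjectClass u s ↔ IsSplitBy N u.arrow v.arrow s b)) :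
    (∀ b b' : B, IsGLB {(ψ b).1, (ψ b').1} (ψ (b ⊓ b')).1) ∧
      (∀ b b' : B, IsLUB {(ψ b).1, (ψ b').1} (ψ (b ⊔ b')).1) ∧
      IsTop (ψ ⊤).1 ∧ IsBot (ψ ⊥).1 ∧ (∀ b : B, AreComplements (ψ b).1 (ψ bᶜ).1) := by
  have hrep (b : B) : ∃ (x : C) (s : (globalSections N).obj x) (u v : Subobject x),
      AreComplements u v ∧ (ψ b).1 = subobjectClass u s := by
    obtain ⟨q, hq⟩ := (ψ b).2
    obtain ⟨x, s, u, v, huv, h, -⟩ := exists_areComplements_eq_subobjectClass hC hκ.1 hq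
    exact ⟨x, s, u, v, huv, h⟩
  have hrep₂ (b b' : B) : ∃ (x : C) (s : (globalSections N).obj x) (u v u' v' : Subobject x),
      AreComplements u v ∧ AreComplements u' v' ∧ (ψ b).1 = subobjectClass u s ∧
        (ψ b').1 = subobjectClass u' s := by
    obtain ⟨x, s, u, v, huv, h⟩ := hrep b
    obtain ⟨y, t, u', v', huv', h'⟩ := hrep b'
    obtain ⟨z, r, f, g, rfl, rfl⟩ := exists_common_refinement s t
    exact ⟨z, r, _, _, _, _, huv.pullback hC hκ.1 f, huv'.pullback hC hκ.1 g,
      h.trans (subobjectClass_pullback f u r).symm, h'.trans (subobjectClass_pullback g u' r).symm⟩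
  have hcompl (b : B) : AreComplements (ψ b).1 (ψ bᶜ).1 := by
    obtain ⟨x, s, u, v, huv, h⟩ := hrep b
    have h' := (hψ bᶜ x s v u huv.symm).2 (isSplitBy_compl ((hψ b x s u v huv).1 h))
    rw [h, h']
    exact areComplements_subobjectClass hC hκ.1 huv s
  have htop : IsTop (ψ ⊤).1 :=
    (hcompl ⊤).2 _ le_rfl (ψ.monotone le_top)
  have hbot : IsBot (ψ ⊥).1 :=
    (hcompl ⊥).1 _ le_rfl (ψ.monotone bot_le)
  refine ⟨fun b b' => ?_, fun b b' => ?_, htop, hbot, hcompl⟩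
  · obtain ⟨x, s, u, v, u', v', huv, huv', h, h'⟩ := hrep₂ b b'
    obtain ⟨d, hd₁, hd₂, hd⟩ := hC.exists_stable_sup hκ.1 v v'
    have hinf := isGLB_subobjectClass u u' s
    rw [← h, ← h'] at hinf
    have hc := areComplements_subobjectClass hC hκ.1 (huv.inf hC hκ.1 huv' hd₁ hd₂ hd) s
    obtain ⟨c, hc⟩ := ψ.surjective ⟨_, _, hc⟩
    rw [← show (ψ c).1 = subobjectClass (u ⊓ u') s from congrArg Subtype.val hc] at hinf
    convert hinf using 3
    refine le_antisymm (ψ.le_iff_le.1 (hinf.2 ?_))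
      (le_inf (ψ.le_iff_le.1 (hinf.1 (Set.mem_insert _ _)))
        (ψ.le_iff_le.1 (hinf.1 (Set.mem_insert_of_mem _ rfl))))
    rintro _ (rfl | rfl)
    · exact ψ.monotone inf_le_left
    · exact ψ.monotone inf_le_right
  · obtain ⟨x, s, u, v, u', v', huv, huv', h, h'⟩ := hrep₂ b b'
    obtain ⟨d, hd₁, hd₂, hd⟩ := hC.exists_stable_sup hκ.1 u u'
    have hsup := isLUB_subobjectClass s hd₁ hd₂ hd
    rw [← h, ← h'] at hsup
    have hc := areComplements_subobjectClass hC hκ.1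
      (huv.symm.inf hC hκ.1 huv'.symm hd₁ hd₂ hd).symm s
    obtain ⟨c, hc⟩ := ψ.surjective ⟨_, _, hc⟩
    rw [← show (ψ c).1 = subobjectClass d s from congrArg Subtype.val hc] at hsup
    convert hsup using 3
    refine le_antisymm (sup_le (ψ.le_iff_le.1 (hsup.1 (Set.mem_insert _ _)))
      (ψ.le_iff_le.1 (hsup.1 (Set.mem_insert_of_mem _ rfl)))) (ψ.le_iff_le.1 (hsup.2 ?_))
    rintro _ (rfl | rfl)
    · exact ψ.monotone le_sup_left
    · exact ψ.monotone le_sup_right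

end Isomorphism

theorem mainTheorem8 {κ : Cardinal.{u}} (hκ : IsWeaklyCompact κ)
    {C : Type u} [SmallCategory C] (hC : IsCoherentCategory κ κ C)
    (hC' : HasSmallDisjointCoproducts κ C)
    {B : Type u} [BooleanAlgebra B] (hB : IsCoherentCategory κ κ B)
    (N : C ⥤ Sheaf (unionTopology hκ.isRegular B) (Type u)) (hN : IsCoherentFunctor κ κ N) :
    haveI : HasFiniteLimits C := hC.isLex.hasFiniteLimits hκ.isRegular.1
    haveI : HasFiniteCoproducts C := hC'.hasFiniteCoproducts hκ.isRegular.1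
    ∃ _ : HasTerminal (SliceColimit (globalSections N)),
    -- the complemented subobjects of `1` in `C_{ΓN}` form the colimit of the posets `Sub^¬(x)`
    ((∀ (x : C) (s : (globalSections N).obj x) (u : ComplementedSubobject x),
        ∃ p : ComplementedSubobject (⊤_ (SliceColimit (globalSections N))),
          IsClassOf p.1 u.1.arrow s) ∧
      (∀ p : ComplementedSubobject (⊤_ (SliceColimit (globalSections N))),
        ∃ (x : C) (s : (globalSections N).obj x) (u : ComplementedSubobject x),
          IsClassOf p.1 u.1.arrow s) ∧
      (∀ (x y : C) (s : (globalSections N).obj x) (t : (globalSections N).obj y)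
        (u : ComplementedSubobject x) (v : ComplementedSubobject y)
        (p q : ComplementedSubobject (⊤_ (SliceColimit (globalSections N)))),
        IsClassOf p.1 u.1.arrow s → IsClassOf q.1 v.1.arrow t →
        (p ≤ q ↔ ∃ (z : C) (r : (globalSections N).obj z) (f : z ⟶ x) (g : z ⟶ y),
          (globalSections N).map f r = s ∧ (globalSections N).map g r = t ∧
          (Subobject.pullback f).obj u.1 ≤ (Subobject.pullback g).obj v.1))) ∧
    ∃ ψ : B ≃o ComplementedSubobject (⊤_ (SliceColimit (globalSections N))),
      -- `ψ` is compatible with the Boolean operations, computed among all subobjects of `1`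
      ((∀ b b' : B, IsGLB {(ψ b).1, (ψ b').1} (ψ (b ⊓ b')).1) ∧
        (∀ b b' : B, IsLUB {(ψ b).1, (ψ b').1} (ψ (b ⊔ b')).1) ∧
        IsTop (ψ ⊤).1 ∧ IsBot (ψ ⊥).1 ∧
        (∀ b : B, AreComplements (ψ b).1 (ψ bᶜ).1)) ∧
      -- `ψ b` is the class of `1 ⊔ ∅ ↪ 1 ⊔ 1` marked with the section glued from the restrictions
      -- of the first injection to `b` and of the second one to `bᶜ`
      (∀ b : B,
        (∃! s : (globalSections N).obj ((⊤_ C) ⨿ (⊤_ C)),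
          IsSplitBy N (coprod.inl : ⊤_ C ⟶ (⊤_ C) ⨿ (⊤_ C)) coprod.inr s b) ∧
        (∀ s : (globalSections N).obj ((⊤_ C) ⨿ (⊤_ C)),
          IsSplitBy N (coprod.inl : ⊤_ C ⟶ (⊤_ C) ⨿ (⊤_ C)) coprod.inr s b →
          IsClassOf (ψ b).1 (coprod.map (𝟙 (⊤_ C)) (initial.to (⊤_ C))) s)) ∧
      -- the inverse of `ψ`
      (∀ (x : C) (s : (globalSections N).obj x) (u v : Subobject x), AreComplements u v →
        ∀ p : ComplementedSubobject (⊤_ (SliceColimit (globalSections N))),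
          IsClassOf p.1 u.arrow s →
          ∀ b : B, ψ.symm p = b ↔ IsSplitBy N u.arrow v.arrow s b) := by
  have : HasFiniteLimits C := hC.isLex.hasFiniteLimits hκ.isRegular.1
  have : HasFiniteCoproducts C := hC'.hasFiniteCoproducts hκ.isRegular.1
  have : PreservesFiniteLimits N := hN.isLex.preservesFiniteLimits hκ.isRegular.1
  have hlam := hκ.isRegular.1
  refine ⟨inferInstance, ⟨?_, ?_, ?_⟩, ?_⟩
  · rintro x s ⟨u, v, huv⟩
    exact ⟨⟨subobjectClass u s, _, areComplements_subobjectClass hC hlam huv s⟩,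
      (isClassOf_arrow_iff _ _ _).2 rfl⟩
  · rintro ⟨p, q, hpq⟩
    obtain ⟨x, s, u, v, huv, rfl, rfl⟩ := exists_areComplements_eq_subobjectClass hC hlam hpq
    exact ⟨x, s, ⟨u, v, huv⟩, (isClassOf_arrow_iff _ _ _).2 rfl⟩
  · intro x y s t u v p q hp hq
    rw [isClassOf_arrow_iff] at hp hq
    rw [← Subtype.coe_le_coe, hp, hq, subobjectClass_le_iff]
  obtain ⟨ψ, hψ⟩ := exists_orderIso hC hC' hB hN
  refine ⟨ψ, ?_, fun b => ⟨existsUnique_isSplitBy_of_terminal _ _ b, fun s hs => ?_⟩, ?_⟩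
  · exact orderIso_preserves_boolean_operations hC ψ hψ
  · have := hC'.binaryCoproductDisjoint hlam (⊤_ C) (⊤_ C)
    obtain ⟨hm, e⟩ := subobject_mk_coprod_map_initial (⊤_ C) (⊤_ C)
    rw [isClassOf_iff, e, hψ _ _ _ _ _ (areComplements_coprod _ _), isSplitBy_mk_iff]
    exact hs
  · intro x s u v huv p hp b
    rw [isClassOf_arrow_iff] at hp
    rw [← hψ _ _ _ _ _ huv, ← hp, Subtype.coe_inj, OrderIso.symm_apply_eq, eq_comm]
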